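/- Let $N\ge 1$, let $\Omega\subset\mathbb R^N$ be a bounded domain with smooth boundary $\Gamma$, and let $b\in L^\infty(\Gamma)$ with $b\ge b_0>0$ almost everywhere on $\Gamma$. Let $p\ge 2$, $q=p/(p-1)$, $r_1,r_2\in[1,\infty)$ with dual exponents $r_1',r_2'$, and let $h_1\in L^{r_1'}(\Omega)$, $h_2\in L^{r_2'}(\Gamma)$. Let $a\in C(\mathbb R,\mathbb R)$ be such that $y\mapsto a(|y|^2)y$ is $C^1$ on $\mathbb R^N$ and, for some constants $c_1,\nu>0$ and all $y,y_1,y_2\in\mathbb R^N$, $$|a(|y|^2)|\le c_1(1+|y|^{p-2}),\qquad a(|y|^2)|y|^2\ge\nu|y|^p,\qquad \langle a(|y_1|^2)y_1-a(|y_2|^2)y_2,\;y_1-y_2\rangle\ge 0 .$$ Let $f,g\in C^1(\mathbb R,\mathbb R)$. Consider the problem $$\partial_t u-\operatorname{div}(a(|\nabla u|^2)\nabla u)+f(u)=h_1\ \text{ in }\Omega,\qquad \partial_t u+b\,a(|\nabla u|^2)\,\partial_{\mathbf n}u+g(u)=h_2\ \text{ on }\Gamma .$$ Write $\mathbb X^2=L^2(\Omega)\oplus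 L^2(\Gamma,dS/b)$, $\mathbb X^\infty=L^\infty(\Omega)\oplus L^\infty(\Gamma)$, and $\mathbb V^{k,p}=\{(\sigma,\sigma_{|\Gamma}):\sigma\in W^{k,p}(\Omega)\}$, where $$k=\max\Big(1,\ \tfrac Np-\tfrac N{r_1},\ \tfrac Np-\tfrac{N-1}{r_2}\Big),\qquad s=\min(q,r_1',r_2').$$ A weak solution on $[0,T]$ with initial datum $U_0\in\mathbb X^2$ is a pair $U=(u,v)\in L^\infty(0,T;\mathbb X^2)\cap W^{1,s}(0,T;(\mathbb V^{k,p})^*)$, weakly continuous from $[0,T]$ to $\mathbb X^2$, with $U(0)=U_0$, $u\in L^p(0,T;W^{1,p}(\Omega))$, $v\in L^p(0,T;W^{1-1/p,p}(\Gamma))$, $v(t)=u(t)_{|\Gamma}$ in the trace sense for a.e. $t\in(0,T)$, and such that for every $\Xi=(\sigma,\sigma_{|\Gamma})\in\mathbb V^{k,p}$ and a.e. $t\in(0,T)$ the functions $f(u(t))\sigma$ and $g(v(t))\sigma_{|\Gamma}/b$ are integrable on $\Omega$ and $\Gamma$, respectively, and $$\langle\partial_tU(t),\Xi\rangle+\int_\Omega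 a(|\nabla u|^2)\nabla u\cdot\nabla\sigma\,dx+\int_\Omega f(u)\sigma\,dx+\int_\Gamma g(v)\sigma\,\frac{dS}b=\int_\Omega h_1\sigma\,dx+\int_\Gamma h_2\sigma\,\frac{dS}b .$$ **Theorem.** Let $T>0$ and let $U_1,U_2\in C([0,T];\mathbb X^2)$ be two weak solutions on $[0,T]$ that are bounded in $\mathbb X^\infty$, i.e. $\operatorname{ess\,sup}_{t\in(0,T)}\|U_i(t)\|_{\mathbb X^\infty}<\infty$ for $i=1,2$. If $U_1(0)=U_2(0)$, then $U_1(t)=U_2(t)$ for all $t\in[0,T]$. -/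

import Mathlib

open MeasureTheory Filter Topology Set
open scoped ENNReal ContDiff

noncomputable section

namespace DynBC

/-- The ambient Euclidean space `ℝ^N`. -/
abbrev E (N : ℕ) : Type := EuclideanSpace ℝ (Fin N)

/-- The coordinate vectors of `ℝ^N`. -/
def coordVec {N : ℕ} (i : Fin N) : E N := EuclideanSpace.single i 1

instance factOneLeOfReal (p : ℝ) [h : Fact (1 < p)] : Fact (1 ≤ ENNReal.ofReal p) :=
  ⟨by simpa using ENNReal.ofReal_le_ofReal h.out.le⟩

/-! ### Domain, boundary, and surface measure -/

/-- `Ω` has a smooth boundary: near each boundary point it is the sublevel set of a smooth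
function with nonvanishing differential. -/
def HasSmoothBoundary {N : ℕ} (Ω : Set (E N)) : Prop :=
  ∀ x ∈ frontier Ω, ∃ (O : Set (E N)) (ρ : E N → ℝ), IsOpen O ∧ x ∈ O ∧ ContDiff ℝ ∞ ρ ∧
    fderiv ℝ ρ x ≠ 0 ∧ Ω ∩ O = {y ∈ O | ρ y < 0}

/-- The surface measure `dS` on `Γ = ∂Ω`: the `(N-1)`-dimensional Hausdorff measure, normalized
to agree with Lebesgue measure in dimension `N-1`. -/
def surface {N : ℕ} (Ω : Set (E N)) : Measure (E N) :=
  (Measure.euclideanHausdorffMeasure (N - 1)).restrict (frontier Ω)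

/-- The weighted surface measure `dS / b` on `Γ`. -/
def bdry {N : ℕ} (Ω : Set (E N)) (b : E N → ℝ) : Measure (E N) :=
  (surface Ω).withDensity fun x => ENNReal.ofReal (1 / b x)

/-- Lebesgue measure on `Ω`. -/
abbrev vol {N : ℕ} (Ω : Set (E N)) : Measure (E N) := volume.restrict Ω

/-- `X² = L²(Ω) ⊕ L²(Γ, dS/b)`, as a Hilbert space. -/
abbrev X2 {N : ℕ} (Ω : Set (E N)) (b : E N → ℝ) : Type :=
  WithLp 2 (Lp ℝ 2 (vol Ω) × Lp ℝ 2 (bdry Ω b))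

/-- The norm of `X^∞ = L^∞(Ω) ⊕ L^∞(Γ)`, with value `∞` off `X^∞`. -/
def xInftyNorm {N : ℕ} {Ω : Set (E N)} {b : E N → ℝ} (U : X2 Ω b) : ℝ≥0∞ :=
  max (eLpNorm U.fst ∞ (vol Ω)) (eLpNorm U.snd ∞ (bdry Ω b))

/-! ### Sobolev spaces -/

/-- `w` is the weak partial derivative `∂_{α 0} ⋯ ∂_{α (j-1)} u` on `Ω`. -/
def HasWeakPartial {N : ℕ} (Ω : Set (E N)) {j : ℕ} (α : Fin j → Fin N) (u w : E N → ℝ) : Prop :=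
  ∀ φ : E N → ℝ, ContDiff ℝ ∞ φ → HasCompactSupport φ → tsupport φ ⊆ Ω →
    ∫ x in Ω, u x * iteratedFDeriv ℝ j φ x (fun l => coordVec (α l)) =
      (-1) ^ j * ∫ x in Ω, w x * φ x

/-- Candidates for the tuple of all partial derivatives of order at most `m` of a function in
`L^p(Ω)`, together with the Gagliardo difference quotients of those of order `m`. -/
abbrev Jet {N : ℕ} (Ω : Set (E N)) (m : ℕ) (p : ℝ) : Type :=
  ((j : Fin (m + 1)) → (Fin (j : ℕ) → Fin N) → Lp ℝ (ENNReal.ofReal p) (vol Ω)) ×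
    ((Fin m → Fin N) → Lp ℝ (ENNReal.ofReal p) ((vol Ω).prod (vol Ω)))

/-- The function underlying a jet (its component of order `0`). -/
def Jet.fn {N : ℕ} {Ω : Set (E N)} {m : ℕ} {p : ℝ} (z : Jet Ω m p) : E N → ℝ :=
  z.1 ⟨0, m.succ_pos⟩ Fin.elim0

/-- The first partial derivative `∂_i` recorded in a jet (only used for `m ≥ 1`). -/
def Jet.part {N : ℕ} {Ω : Set (E N)} {m : ℕ} {p : ℝ} (z : Jet Ω m p) (i : Fin N) : E N → ℝ :=
  if h : 1 ≤ m then z.1 ⟨1, Nat.lt_succ_of_le h⟩ (fun _ => i) else 0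

/-- The gradient recorded in a jet. -/
def Jet.grad {N : ℕ} {Ω : Set (E N)} {m : ℕ} {p : ℝ} (z : Jet Ω m p) (x : E N) : E N :=
  WithLp.toLp 2 fun i => z.part i x

/-- The jet `z` consists of the weak derivatives of `z.fn`, and, when `0 < θ < 1`, of the quotients
`(∂^α u(x) - ∂^α u(y)) / |x - y|^{N/p + θ}` for `|α| = m`; for `θ = 0` these are not present. -/
def IsSobolevJet {N : ℕ} {Ω : Set (E N)} {m : ℕ} (θ : ℝ) {p : ℝ} (z : Jet Ω m p) : Prop :=
  (∀ (j : Fin (m + 1)) (α : Fin (j : ℕ) → Fin N), HasWeakPartial Ω α z.fn (z.1 j α)) ∧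
  ∀ α : Fin m → Fin N,
    (θ = 0 → z.2 α = 0) ∧
    (θ ≠ 0 → ∀ᵐ y ∂((vol Ω).prod (vol Ω)),
      z.2 α y = (z.1 (Fin.last m) α y.1 - z.1 (Fin.last m) α y.2) / ‖y.1 - y.2‖ ^ (N / p + θ))

lemma integrable_mul_test {N : ℕ} {Ω : Set (E N)} {p : ℝ} [hp : Fact (1 < p)]
    (u : Lp ℝ (ENNReal.ofReal p) (vol Ω)) {ψ : E N → ℝ} (hψ : Continuous ψ)
    (hc : HasCompactSupport ψ) : Integrable (fun x => u x * ψ x) (vol Ω) := by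
  have : ENNReal.HolderConjugate (ENNReal.ofReal p) (ENNReal.ofReal p).conjExponent :=
    ENNReal.HolderConjugate.conjExponent (factOneLeOfReal p).out
  exact MemLp.integrable_mul (Lp.memLp u)
    (hψ.memLp_of_hasCompactSupport hc (p := (ENNReal.ofReal p).conjExponent))

lemma test_deriv {N j : ℕ} (α : Fin j → Fin N) {φ : E N → ℝ} (hφ : ContDiff ℝ ∞ φ)
    (hc : HasCompactSupport φ) :
    Continuous (fun x => iteratedFDeriv ℝ j φ x (fun l => coordVec (α l))) ∧
      HasCompactSupport (fun x => iteratedFDeriv ℝ j φ x (fun l => coordVec (α l))) := by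
  constructor
  · have h : Continuous (iteratedFDeriv ℝ j φ) :=
      hφ.continuous_iteratedFDeriv (by exact_mod_cast le_top)
    exact (ContinuousMultilinearMap.apply ℝ (fun _ : Fin j => E N) ℝ
      (fun l => coordVec (α l))).continuous.comp h
  · exact (hc.iteratedFDeriv (𝕜 := ℝ) j).comp_left
      (g := fun T : ContinuousMultilinearMap ℝ (fun _ : Fin j => E N) ℝ =>
        T (fun l => coordVec (α l))) rfl

lemma HasWeakPartial.lin {N : ℕ} {Ω : Set (E N)} {p : ℝ} [Fact (1 < p)] {j : ℕ}
    {α : Fin j → Fin N} {u w u' w' : Lp ℝ (ENNReal.ofReal p) (vol Ω)} (c : ℝ)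
    (h : HasWeakPartial Ω α u w) (h' : HasWeakPartial Ω α u' w') :
    HasWeakPartial Ω α (u + c • u' : Lp ℝ (ENNReal.ofReal p) (vol Ω))
      (w + c • w' : Lp ℝ (ENNReal.ofReal p) (vol Ω)) := by
  intro φ hφ hc hs
  have key : ∀ (a a' : Lp ℝ (ENNReal.ofReal p) (vol Ω)) (ψ : E N → ℝ), Continuous ψ →
      HasCompactSupport ψ →
      ∫ x in Ω, (a + c • a' : Lp ℝ (ENNReal.ofReal p) (vol Ω)) x * ψ x =
        (∫ x in Ω, a x * ψ x) + c * ∫ x in Ω, a' x * ψ x := by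
    intro a a' ψ hψ hψc
    rw [← integral_const_mul, ← integral_add (integrable_mul_test a hψ hψc)
      ((integrable_mul_test a' hψ hψc).const_mul c)]
    apply integral_congr_ae
    filter_upwards [Lp.coeFn_add a (c • a'), Lp.coeFn_smul c a'] with x h1 h2
    simp only [h1, Pi.add_apply, h2, Pi.smul_apply, smul_eq_mul]
    ring
  obtain ⟨d1, d2⟩ := test_deriv α hφ hc
  rw [key _ _ _ d1 d2, key _ _ _ hφ.continuous hc, h φ hφ hc hs, h' φ hφ hc hs]
  ring

lemma isSobolevJet_zero {N : ℕ} {Ω : Set (E N)} {m : ℕ} (θ : ℝ) {p : ℝ} :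
    IsSobolevJet θ (0 : Jet Ω m p) := by
  have hz : ((0 : Lp ℝ (ENNReal.ofReal p) (vol Ω)) : E N → ℝ) =ᵐ[vol Ω] 0 := Lp.coeFn_zero _ _ _
  refine ⟨fun j α φ _ _ _ => ?_, fun α => ⟨fun _ => rfl, fun _ => ?_⟩⟩
  · have h1 : ∀ ψ : E N → ℝ,
        ∫ x in Ω, ((0 : Lp ℝ (ENNReal.ofReal p) (vol Ω)) : E N → ℝ) x * ψ x = 0 := by
      intro ψ
      rw [integral_congr_ae (g := fun _ => (0 : ℝ)), integral_zero]
      filter_upwards [hz] with x hx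
      rw [hx, Pi.zero_apply, zero_mul]
    have h2 := h1 (fun x => iteratedFDeriv ℝ j φ x (fun l => coordVec (α l)))
    have h3 := h1 φ
    change ∫ x in Ω, ((0 : Lp ℝ (ENNReal.ofReal p) (vol Ω)) : E N → ℝ) x * _ =
      _ * ∫ x in Ω, ((0 : Lp ℝ (ENNReal.ofReal p) (vol Ω)) : E N → ℝ) x * _
    rw [h2, h3, mul_zero]
  · filter_upwards [Measure.quasiMeasurePreserving_fst.ae_eq_comp hz,
      Measure.quasiMeasurePreserving_snd.ae_eq_comp hz,
      Lp.coeFn_zero ℝ (ENNReal.ofReal p) ((vol Ω).prod (vol Ω))] with y h1 h2 h3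
    change ((0 : Lp ℝ (ENNReal.ofReal p) ((vol Ω).prod (vol Ω))) : E N × E N → ℝ) y =
      (((0 : Lp ℝ (ENNReal.ofReal p) (vol Ω)) : E N → ℝ) y.1 -
        ((0 : Lp ℝ (ENNReal.ofReal p) (vol Ω)) : E N → ℝ) y.2) / _
    simp only [Function.comp_apply, Pi.zero_apply] at h1 h2 h3
    rw [h1, h2, h3]
    simp

lemma IsSobolevJet.lin {N : ℕ} {Ω : Set (E N)} {m : ℕ} {θ p : ℝ} [Fact (1 < p)]
    {z z' : Jet Ω m p} (c : ℝ) (h : IsSobolevJet θ z) (h' : IsSobolevJet θ z') :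
    IsSobolevJet θ (z + c • z') := by
  refine ⟨fun j α => (h.1 j α).lin c (h'.1 j α), fun α => ⟨fun h0 => ?_, fun h0 => ?_⟩⟩
  · change z.2 α + c • z'.2 α = 0
    rw [(h.2 α).1 h0, (h'.2 α).1 h0]
    simp
  · have e : ((z.1 (Fin.last m) α + c • z'.1 (Fin.last m) α :
        Lp ℝ (ENNReal.ofReal p) (vol Ω)) : E N → ℝ) =ᵐ[vol Ω]
        fun x => z.1 (Fin.last m) α x + c * z'.1 (Fin.last m) α x := by
      filter_upwards [Lp.coeFn_add (z.1 (Fin.last m) α) (c • z'.1 (Fin.last m) α),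
        Lp.coeFn_smul c (z'.1 (Fin.last m) α)] with x h1 h2
      rw [h1, Pi.add_apply, h2, Pi.smul_apply, smul_eq_mul]
    filter_upwards [Measure.quasiMeasurePreserving_fst.ae_eq_comp e,
      Measure.quasiMeasurePreserving_snd.ae_eq_comp e, (h.2 α).2 h0, (h'.2 α).2 h0,
      Lp.coeFn_add (z.2 α) (c • z'.2 α), Lp.coeFn_smul c (z'.2 α)] with y h1 h2 h3 h4 h5 h6
    change ((z.2 α + c • z'.2 α : Lp ℝ (ENNReal.ofReal p) ((vol Ω).prod (vol Ω))) :
        E N × E N → ℝ) y =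
      (((z.1 (Fin.last m) α + c • z'.1 (Fin.last m) α : Lp ℝ (ENNReal.ofReal p) (vol Ω)) :
          E N → ℝ) y.1 -
        ((z.1 (Fin.last m) α + c • z'.1 (Fin.last m) α : Lp ℝ (ENNReal.ofReal p) (vol Ω)) :
          E N → ℝ) y.2) / _
    simp only [Function.comp_apply] at h1 h2
    rw [h1, h2, h5]
    simp only [Pi.add_apply, h6, Pi.smul_apply, smul_eq_mul, h3, h4]
    ring

/-- The Sobolev(-Slobodeckij) space `W^{m+θ,p}(Ω)`, `m ∈ ℕ`, `0 ≤ θ < 1`, with the norm inherited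
from the jets (equivalent to the usual one). -/
def Sobolev {N : ℕ} (Ω : Set (E N)) (m : ℕ) (θ p : ℝ) [Fact (1 < p)] :
    Submodule ℝ (Jet Ω m p) where
  carrier := {z | IsSobolevJet θ z}
  zero_mem' := isSobolevJet_zero θ
  add_mem' := fun {z z'} h h' => by
    have := IsSobolevJet.lin 1 h h'
    rwa [one_smul] at this
  smul_mem' := fun c z h => by
    have := IsSobolevJet.lin c (isSobolevJet_zero θ) h
    rwa [zero_add] at this

instance instNormedAddCommGroupSobolev {N : ℕ} (Ω : Set (E N)) (m : ℕ) (θ p : ℝ) [Fact (1 < p)] :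
    NormedAddCommGroup (Sobolev Ω m θ p) := (Sobolev Ω m θ p).normedAddCommGroup

instance instNormedSpaceSobolev {N : ℕ} (Ω : Set (E N)) (m : ℕ) (θ p : ℝ) [Fact (1 < p)] :
    NormedSpace ℝ (Sobolev Ω m θ p) := (Sobolev Ω m θ p).normedSpace

/-! ### Traces -/

/-- `v` is the trace on `Γ` of the function `u ∈ W^{1,p}(Ω)` with first partial derivatives `D i`:
the limit in `L^p(Γ)` of the boundary values of smooth functions converging to `u` in
`W^{1,p}(Ω)`. -/
def IsTrace {N : ℕ} (Ω : Set (E N)) (b : E N → ℝ) (p : ℝ) (u : E N → ℝ) (D : Fin N → E N → ℝ)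
    (v : E N → ℝ) : Prop :=
  ∃ φ : ℕ → E N → ℝ, (∀ n, ContDiff ℝ ∞ (φ n)) ∧
    Tendsto (fun n => eLpNorm (fun x => φ n x - u x) (ENNReal.ofReal p) (vol Ω)) atTop (𝓝 0) ∧
    (∀ i, Tendsto (fun n => eLpNorm (fun x => fderiv ℝ (φ n) x (coordVec i) - D i x)
      (ENNReal.ofReal p) (vol Ω)) atTop (𝓝 0)) ∧
    Tendsto (fun n => eLpNorm (fun x => φ n x - v x) (ENNReal.ofReal p) (bdry Ω b)) atTop (𝓝 0)

lemma tendsto_lin {α : Type*} [MeasurableSpace α] {μ : Measure α} {q : ℝ≥0∞} (hq : 1 ≤ q)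
    {F F' : ℕ → α → ℝ} {u u' w : α → ℝ} (c : ℝ)
    (hF : ∀ n, AEStronglyMeasurable (F n) μ) (hF' : ∀ n, AEStronglyMeasurable (F' n) μ)
    (hu : AEStronglyMeasurable u μ) (hu' : AEStronglyMeasurable u' μ)
    (hw : w =ᵐ[μ] fun x => u x + c * u' x)
    (h : Tendsto (fun n => eLpNorm (fun x => F n x - u x) q μ) atTop (𝓝 0))
    (h' : Tendsto (fun n => eLpNorm (fun x => F' n x - u' x) q μ) atTop (𝓝 0)) :
    Tendsto (fun n => eLpNorm (fun x => (F n x + c * F' n x) - w x) q μ) atTop (𝓝 0) := by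
  have hlim : Tendsto (fun n => eLpNorm (fun x => F n x - u x) q μ +
      ‖c‖ₑ * eLpNorm (fun x => F' n x - u' x) q μ) atTop (𝓝 0) := by
    have := h.add (ENNReal.Tendsto.const_mul (a := ‖c‖ₑ) h' (Or.inr (by simp)))
    simpa using this
  refine tendsto_of_tendsto_of_tendsto_of_le_of_le tendsto_const_nhds hlim
    (fun n => zero_le) (fun n => ?_)
  calc eLpNorm (fun x => (F n x + c * F' n x) - w x) q μ
      = eLpNorm ((fun x => F n x - u x) + c • fun x => F' n x - u' x) q μ := by
        apply eLpNorm_congr_ae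
        filter_upwards [hw] with x hx
        simp only [hx, Pi.add_apply, Pi.smul_apply, smul_eq_mul]
        ring
    _ ≤ eLpNorm (fun x => F n x - u x) q μ + eLpNorm (c • fun x => F' n x - u' x) q μ :=
        eLpNorm_add_le ((hF n).sub hu) (((hF' n).sub hu').const_smul c) hq
    _ = _ := by rw [eLpNorm_const_smul]

lemma IsTrace.lin {N : ℕ} {Ω : Set (E N)} {b : E N → ℝ} {p : ℝ} [Fact (1 < p)]
    {u u' uu v v' vv : E N → ℝ} {D D' DD : Fin N → E N → ℝ} (c : ℝ)
    (mu : AEStronglyMeasurable u (vol Ω)) (mu' : AEStronglyMeasurable u' (vol Ω))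
    (mD : ∀ i, AEStronglyMeasurable (D i) (vol Ω))
    (mD' : ∀ i, AEStronglyMeasurable (D' i) (vol Ω))
    (mv : AEStronglyMeasurable v (bdry Ω b)) (mv' : AEStronglyMeasurable v' (bdry Ω b))
    (hu : uu =ᵐ[vol Ω] fun x => u x + c * u' x)
    (hD : ∀ i, DD i =ᵐ[vol Ω] fun x => D i x + c * D' i x)
    (hv : vv =ᵐ[bdry Ω b] fun x => v x + c * v' x)
    (h : IsTrace Ω b p u D v) (h' : IsTrace Ω b p u' D' v') : IsTrace Ω b p uu DD vv := by
  obtain ⟨φ, s, a1, a2, a3⟩ := h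
  obtain ⟨φ', s', a1', a2', a3'⟩ := h'
  have hq : 1 ≤ ENNReal.ofReal p := Fact.out
  have cd : ∀ (ψ : E N → ℝ) (i : Fin N), ContDiff ℝ ∞ ψ →
      Continuous (fun x => fderiv ℝ ψ x (coordVec i)) := fun ψ i hψ =>
    (hψ.continuous_fderiv (by simp)).clm_apply continuous_const
  refine ⟨fun n x => φ n x + c * φ' n x, fun n => (s n).add (contDiff_const.mul (s' n)),
    tendsto_lin hq c (fun n => (s n).continuous.aestronglyMeasurable)
      (fun n => (s' n).continuous.aestronglyMeasurable) mu mu' hu a1 a1',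
    fun i => ?_,
    tendsto_lin hq c (fun n => (s n).continuous.aestronglyMeasurable)
      (fun n => (s' n).continuous.aestronglyMeasurable) mv mv' hv a3 a3'⟩
  have key := tendsto_lin hq c (fun n => (cd _ i (s n)).aestronglyMeasurable)
    (fun n => (cd _ i (s' n)).aestronglyMeasurable) (mD i) (mD' i) (hD i) (a2 i) (a2' i)
  refine key.congr fun n => ?_
  congr 1
  ext x
  have e1 : DifferentiableAt ℝ (φ n) x := (s n).differentiable (by simp) x
  have e2 : DifferentiableAt ℝ (φ' n) x := (s' n).differentiable (by simp) x
  rw [fderiv_fun_add e1 (e2.const_mul c), fderiv_const_mul e2]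
  simp

lemma Jet.aesm_fn {N : ℕ} {Ω : Set (E N)} {m : ℕ} {p : ℝ} (z : Jet Ω m p) :
    AEStronglyMeasurable z.fn (vol Ω) := Lp.aestronglyMeasurable _

lemma Jet.aesm_part {N : ℕ} {Ω : Set (E N)} {m : ℕ} {p : ℝ} (z : Jet Ω m p) (i : Fin N) :
    AEStronglyMeasurable (z.part i) (vol Ω) := by
  unfold Jet.part
  split_ifs
  · exact Lp.aestronglyMeasurable _
  · exact aestronglyMeasurable_zero

lemma coe_lin {α : Type*} [MeasurableSpace α] {μ : Measure α} {q : ℝ≥0∞} (u v : Lp ℝ q μ)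
    (c : ℝ) : (u + c • v : Lp ℝ q μ) =ᵐ[μ] fun x => u x + c * v x := by
  filter_upwards [Lp.coeFn_add u (c • v), Lp.coeFn_smul c v] with x h1 h2
  rw [h1, Pi.add_apply, h2, Pi.smul_apply, smul_eq_mul]

lemma Jet.fn_lin {N : ℕ} {Ω : Set (E N)} {m : ℕ} {p : ℝ} (z z' : Jet Ω m p) (c : ℝ) :
    (z + c • z').fn =ᵐ[vol Ω] fun x => z.fn x + c * z'.fn x := coe_lin _ _ c

lemma Jet.part_lin {N : ℕ} {Ω : Set (E N)} {m : ℕ} {p : ℝ} (z z' : Jet Ω m p) (c : ℝ)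
    (i : Fin N) : (z + c • z').part i =ᵐ[vol Ω] fun x => z.part i x + c * z'.part i x := by
  unfold Jet.part
  split_ifs
  · exact coe_lin _ _ c
  · simp
    rfl

/-- Membership in `V^{k,p}`: the pair `Ξ = (σ, τ) ∈ X²` consists of a function `σ ∈ W^{k,p}(Ω)`,
with derivatives recorded by `z`, and its trace `τ = σ|_Γ`. -/
def IsVPair {N : ℕ} {Ω : Set (E N)} {b : E N → ℝ} {m : ℕ} {p : ℝ} (Ξ : X2 Ω b) (z : Jet Ω m p) :
    Prop :=
  Ξ.fst =ᵐ[vol Ω] z.fn ∧ IsTrace Ω b p z.fn z.part Ξ.snd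

lemma IsVPair.lin {N : ℕ} {Ω : Set (E N)} {b : E N → ℝ} {m : ℕ} {p : ℝ} [Fact (1 < p)]
    {Ξ Ξ' : X2 Ω b} {z z' : Jet Ω m p} (c : ℝ) (h : IsVPair Ξ z) (h' : IsVPair Ξ' z') :
    IsVPair (Ξ + c • Ξ') (z + c • z') := by
  refine ⟨?_, IsTrace.lin c z.aesm_fn z'.aesm_fn z.aesm_part z'.aesm_part
    (Lp.aestronglyMeasurable _) (Lp.aestronglyMeasurable _) (z.fn_lin z' c) (z.part_lin z' c)
    (coe_lin Ξ.snd Ξ'.snd c) h.2 h'.2⟩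
  filter_upwards [coe_lin Ξ.fst Ξ'.fst c, z.fn_lin z' c, h.1, h'.1] with x h1 h2 h3 h4
  rw [h2, ← h3, ← h4]
  exact h1

lemma isVPair_zero {N : ℕ} {Ω : Set (E N)} {b : E N → ℝ} {m : ℕ} {p : ℝ} :
    IsVPair (0 : X2 Ω b) (0 : Jet Ω m p) := by
  have h1 : (0 : Jet Ω m p).fn =ᵐ[vol Ω] 0 := Lp.coeFn_zero ℝ (ENNReal.ofReal p) (vol Ω)
  have h2 : ((0 : X2 Ω b).fst : E N → ℝ) =ᵐ[vol Ω] 0 := Lp.coeFn_zero ℝ 2 (vol Ω)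
  have h3 : ((0 : X2 Ω b).snd : E N → ℝ) =ᵐ[bdry Ω b] 0 := Lp.coeFn_zero ℝ 2 (bdry Ω b)
  have h4 : ∀ i, (0 : Jet Ω m p).part i =ᵐ[vol Ω] 0 := by
    intro i
    unfold Jet.part
    split_ifs
    · exact Lp.coeFn_zero ℝ (ENNReal.ofReal p) (vol Ω)
    · exact Filter.EventuallyEq.rfl
  have key : ∀ (μ : Measure (E N)) (w : E N → ℝ), w =ᵐ[μ] 0 →
      eLpNorm (fun x => 0 - w x) (ENNReal.ofReal p) μ = 0 := by
    intro μ w hw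
    rw [eLpNorm_congr_ae (g := 0), eLpNorm_zero]
    filter_upwards [hw] with x hx
    simp [hx]
  refine ⟨h2.trans h1.symm, fun _ _ => 0, fun _ => contDiff_const, ?_, fun i => ?_, ?_⟩
  · simp only [key _ _ h1]
    exact tendsto_const_nhds
  · simp only [fderiv_const_apply, _root_.zero_apply, key _ _ (h4 i)]
    exact tendsto_const_nhds
  · simp only [key _ _ h3]
    exact tendsto_const_nhds

/-- The space `V^{k,p} = {(σ, σ|_Γ) : σ ∈ W^{k,p}(Ω)}`, `k ≥ 1`. Its norm is the maximum of the
`X²`-norm and the `W^{k,p}`-norm of `σ`; since `V^{k,p}` embeds into `X²` this is equivalent to the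
`W^{k,p}(Ω)`-norm of `σ`. -/
def V {N : ℕ} (Ω : Set (E N)) (b : E N → ℝ) (k p : ℝ) [Fact (1 < p)] :
    Submodule ℝ (X2 Ω b × Sobolev Ω ⌊k⌋₊ (Int.fract k) p) where
  carrier := {Ξ | IsVPair Ξ.1 (Ξ.2 : Jet Ω ⌊k⌋₊ p)}
  zero_mem' := isVPair_zero
  add_mem' := fun {Ξ Ξ'} h h' => by
    have := IsVPair.lin 1 h h'
    rwa [one_smul, one_smul] at this
  smul_mem' := fun c Ξ h => by
    have := IsVPair.lin c (isVPair_zero (Ω := Ω) (b := b) (p := p)) h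
    rwa [zero_add, zero_add] at this

instance instNormedAddCommGroupV {N : ℕ} (Ω : Set (E N)) (b : E N → ℝ) (k p : ℝ) [Fact (1 < p)] :
    NormedAddCommGroup (V Ω b k p) := (V Ω b k p).normedAddCommGroup

instance instNormedSpaceV {N : ℕ} (Ω : Set (E N)) (b : E N → ℝ) (k p : ℝ) [Fact (1 < p)] :
    NormedSpace ℝ (V Ω b k p) := (V Ω b k p).normedSpace

set_option synthInstance.maxHeartbeats 400000 in
/-- The operator norm on `(V^{k,p})*`. -/
instance instNormedAddCommGroupDualV {N : ℕ} (Ω : Set (E N)) (b : E N → ℝ) (k p : ℝ)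
    [Fact (1 < p)] : NormedAddCommGroup (StrongDual ℝ (V Ω b k p)) :=
  ContinuousLinearMap.toNormedAddCommGroup

set_option synthInstance.maxHeartbeats 400000 in
instance instNormedSpaceDualV {N : ℕ} (Ω : Set (E N)) (b : E N → ℝ) (k p : ℝ)
    [Fact (1 < p)] : NormedSpace ℝ (StrongDual ℝ (V Ω b k p)) :=
  ContinuousLinearMap.toNormedSpace

/-- The inclusion `V^{k,p} ⊂ X²`. -/
def V.toX2 {N : ℕ} (Ω : Set (E N)) (b : E N → ℝ) (k p : ℝ) [Fact (1 < p)] :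
    V Ω b k p →L[ℝ] X2 Ω b :=
  (ContinuousLinearMap.fst ℝ _ _).comp (V Ω b k p).subtypeL

/-- The inclusion `X² = (X²)* ⊂ (V^{k,p})*`. -/
def X2.toDual {N : ℕ} {Ω : Set (E N)} {b : E N → ℝ} (k p : ℝ) [Fact (1 < p)] (U : X2 Ω b) :
    StrongDual ℝ (V Ω b k p) :=
  (innerSL ℝ U).comp (V.toX2 Ω b k p)

/-! ### The equation -/

/-- The structural assumptions on the flux `y ↦ a(|y|²) y`. -/
structure FluxAssumptions (N : ℕ) (p : ℝ) (a : ℝ → ℝ) : Prop where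
  continuous : Continuous a
  contDiff : ContDiff ℝ 1 fun y : E N => a (‖y‖ ^ 2) • y
  growth : ∃ c₁ > 0, ∀ y : E N, |a (‖y‖ ^ 2)| ≤ c₁ * (1 + ‖y‖ ^ (p - 2))
  coercive : ∃ ν > 0, ∀ y : E N, ν * ‖y‖ ^ p ≤ a (‖y‖ ^ 2) * ‖y‖ ^ 2
  monotone : ∀ y₁ y₂ : E N, 0 ≤ inner ℝ (a (‖y₁‖ ^ 2) • y₁ - a (‖y₂‖ ^ 2) • y₂) (y₁ - y₂)

/-- The regularity index `k = max (1, N/p - N/r₁, N/p - (N-1)/r₂)` of the test functions. -/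
def kIndex (N : ℕ) (p r₁ r₂ : ℝ) : ℝ :=
  max 1 (max (N / p - N / r₁) (N / p - ((N : ℝ) - 1) / r₂))

/-- The dual exponent `r'` of `r ∈ [1, ∞)`, with `1' = ∞`. -/
def dualExp (r : ℝ) : ℝ≥0∞ := (ENNReal.ofReal r).conjExponent

/-- The time integrability exponent `s = min (q, r₁', r₂')`, where `q = p/(p-1)`. -/
def sIndex (p r₁ r₂ : ℝ) : ℝ≥0∞ := min (dualExp p) (min (dualExp r₁) (dualExp r₂))

/-- `ξ` is the time derivative of `U` on `(0,T)` as a distribution with values in `(V^{k,p})*`. -/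
def HasTimeDeriv {N : ℕ} {Ω : Set (E N)} {b : E N → ℝ} {k p : ℝ} [Fact (1 < p)] (T : ℝ)
    (U : ℝ → X2 Ω b) (ξ : ℝ → StrongDual ℝ (V Ω b k p)) : Prop :=
  ∀ φ : ℝ → ℝ, ContDiff ℝ ∞ φ → HasCompactSupport φ → tsupport φ ⊆ Ioo 0 T →
    ∫ t in Ioo 0 T, deriv φ t • X2.toDual k p (U t) = -∫ t in Ioo 0 T, φ t • ξ t

/-- `v ∈ L^p(0,T; W^{1-1/p,p}(Γ))`: the functions `v(t)` and their Gagliardo difference quotients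
`(v(t,x) - v(t,y)) / |x-y|^{(N-1)/p + 1 - 1/p}` are in `L^p(0,T; L^p(Γ))` and
`L^p(0,T; L^p(Γ × Γ))`. -/
def BoundaryRegular {N : ℕ} {Ω : Set (E N)} {b : E N → ℝ} (p : ℝ) [Fact (1 < p)] (T : ℝ)
    (v : ℝ → E N → ℝ) : Prop :=
  ∃ B : ℝ → Lp ℝ (ENNReal.ofReal p) (bdry Ω b) ×
      Lp ℝ (ENNReal.ofReal p) ((bdry Ω b).prod (bdry Ω b)),
    MemLp B (ENNReal.ofReal p) (volume.restrict (Ioo 0 T)) ∧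
    ∀ᵐ t ∂(volume.restrict (Ioo 0 T)),
      (B t).1 =ᵐ[bdry Ω b] v t ∧
      (B t).2 =ᵐ[(bdry Ω b).prod (bdry Ω b)] fun y =>
        (v t y.1 - v t y.2) / ‖y.1 - y.2‖ ^ (((N : ℝ) - 1) / p + (1 - 1 / p))

/-- `U = (u, v)` is a weak solution on `[0,T]`, with initial datum `U₀ ∈ X²`, of
`∂ₜu - div(a(|∇u|²)∇u) + f(u) = h₁` in `Ω`, `∂ₜu + b a(|∇u|²) ∂ₙu + g(u) = h₂` on `Γ`.
Here `w t` is `u(t)` as an element of `W^{1,p}(Ω)`, and `ξ t` is `∂ₜU(t)`. The weak continuity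
clause makes the value `U 0` meaningful. -/
def IsWeakSolution {N : ℕ} (Ω : Set (E N)) (b : E N → ℝ) (p : ℝ) [Fact (1 < p)] (r₁ r₂ : ℝ)
    (a f g : ℝ → ℝ) (h₁ h₂ : E N → ℝ) (T : ℝ) (U₀ : X2 Ω b) (U : ℝ → X2 Ω b) : Prop :=
  U 0 = U₀ ∧
  (∀ Ξ : X2 Ω b, ContinuousOn (fun t => inner ℝ Ξ (U t)) (Icc 0 T)) ∧
  MemLp U ∞ (volume.restrict (Ioo 0 T)) ∧
  BoundaryRegular (Ω := Ω) (b := b) p T (fun t => (U t).snd) ∧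
  ∃ (w : ℝ → Sobolev Ω 1 0 p) (ξ : ℝ → StrongDual ℝ (V Ω b (kIndex N p r₁ r₂) p)),
    MemLp w (ENNReal.ofReal p) (volume.restrict (Ioo 0 T)) ∧
    MemLp ξ (sIndex p r₁ r₂) (volume.restrict (Ioo 0 T)) ∧
    HasTimeDeriv T U ξ ∧
    (∀ᵐ t ∂(volume.restrict (Ioo 0 T)), IsVPair (U t) (w t : Jet Ω 1 p)) ∧
    ∀ Ξ : V Ω b (kIndex N p r₁ r₂) p, ∀ᵐ t ∂(volume.restrict (Ioo 0 T)),
      Integrable (fun x => f ((U t).fst x) * Ξ.1.1.fst x) (vol Ω) ∧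
      Integrable (fun x => g ((U t).snd x) * Ξ.1.1.snd x) (bdry Ω b) ∧
      ξ t Ξ
        + (∫ x in Ω, a (‖(w t : Jet Ω 1 p).grad x‖ ^ 2) *
            inner ℝ ((w t : Jet Ω 1 p).grad x) (Jet.grad (Ξ.1.2 : Jet Ω ⌊kIndex N p r₁ r₂⌋₊ p) x))
        + (∫ x in Ω, f ((U t).fst x) * Ξ.1.1.fst x)
        + (∫ x, g ((U t).snd x) * Ξ.1.1.snd x ∂(bdry Ω b))
      = (∫ x in Ω, h₁ x * Ξ.1.1.fst x) + ∫ x, h₂ x * Ξ.1.1.snd x ∂(bdry Ω b)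

end DynBC

end

/-!
The difference `W = U₁ - U₂` is tested with itself. The data `h₁`, `h₂` cancel, the flux is monotone,
and on the common range of two bounded solutions `f` and `g` are Lipschitz, so the expected outcome
is `‖W(s)‖² ≤ 2 K ∫₀ˢ ‖W‖²`, and `W = 0` by Gronwall's lemma. The difficulty is that `W(t)` need not
belong to the space `V^{k,p}` of test functions, and that `∂ₜW` is only a functional on that space,
so neither the test nor the chain rule for `‖W‖²` is available as it stands.

*Density.* The restriction of a smooth function of `ℝ^N` to `Ω` lies in `V^{k,p}` for every `k ≥ 1`
(`exists_mem_V`): its derivatives are bounded, its Gagliardo quotients are in `L^p` since `Ω` is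
bounded, and its boundary values are in `L²(Γ, dS/b)` since `Γ` has finite surface measure
(`isFiniteMeasure_surface`, by the implicit description of the boundary). For such `φ` the weak
formulation is integrated in time (`HasTimeDeriv.inner_sub_eq_integral`), giving
`⟪W(t) - W(s), φ⟫ = (∫ₛᵗ A(τ) dτ)(φ, ∇φ)`, where
`A(τ) = -(reaction difference, flux difference)` is a path in the dual of
`X² × L^p(Ω; ℝ^N)`. Both sides are continuous in `(φ, ∇φ)` for the norm of that space. As traces are
defined by smooth approximation, and `p ≥ 2`, the pair `(W(r), ∇(u₁ - u₂)(r))` is a limit of smooth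
pairs for almost every `r` (`exists_tendsto_smoothPair`), so that `W(r)` itself may be inserted.

*Energy.* By the growth condition `A` is in `L^q(0,T)`, with `q` conjugate to `p`
(`memLp_nemFlux`, `memLp_testFunctional`). Let `h > 0`. From
`‖W(r)‖² - ‖W(r - h)‖² ≤ 2 ⟪W(r) - W(r - h), W(r)⟫` and the identity above, integration over
`r ∈ (0,s)` and division by `h` bound the mean of `‖W‖²` over `(s - h, s)` by the mean over
`σ ∈ (0,h)` of `2 ∫ A(r - σ)(W(r), ∇(u₁ - u₂)(r)) dr`. Translations are continuous in `L^q`, so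
`h → 0` gives `‖W(s)‖² ≤ 2 ∫₀ˢ A(r)(W(r), ∇(u₁ - u₂)(r)) dr` (`norm_sq_le_integral_pairing`). The
integrand is at most `K ‖W(r)‖²` (`testFunctional_le`), and `eq_zero_of_energy` concludes.
-/

noncomputable section
namespace DynBC

/-! ### Functions with an integrable weak time derivative -/

/-- Scaled smooth steps tend to the step at `0`, which vanishes at `0` itself. -/
lemma tendsto_smoothTransition_mul (x : ℝ) :
    Tendsto (fun n : ℕ => Real.smoothTransition (n * x)) atTop
      (𝓝 ((Ioi (0:ℝ)).indicator (fun _ => 1) x)) := by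
  rcases le_or_gt x 0 with hx | hx
  · rw [indicator_of_notMem (by simpa using hx)]
    refine tendsto_const_nhds.congr fun n => ?_
    rw [Real.smoothTransition.zero_of_nonpos (mul_nonpos_of_nonneg_of_nonpos n.cast_nonneg hx)]
  · rw [indicator_of_mem (by simpa using hx)]
    refine tendsto_const_nhds.congr' ?_
    obtain ⟨m, hm⟩ := exists_nat_gt (1 / x)
    filter_upwards [eventually_ge_atTop m] with n hn
    rw [Real.smoothTransition.one_of_one_le]
    have : (m : ℝ) ≤ n := by exact_mod_cast hn
    rw [div_lt_iff₀ hx] at hm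
    nlinarith

lemma deriv_smoothTransition_eq_zero_of_neg {x : ℝ} (hx : x < 0) :
    deriv Real.smoothTransition x = 0 := by
  have : Real.smoothTransition =ᶠ[𝓝 x] fun _ => 0 := by
    filter_upwards [Iio_mem_nhds hx] with y hy
    exact Real.smoothTransition.zero_of_nonpos (le_of_lt hy)
  rw [this.deriv_eq, deriv_const]

lemma deriv_smoothTransition_eq_zero_of_one_lt {x : ℝ} (hx : 1 < x) :
    deriv Real.smoothTransition x = 0 := by
  have : Real.smoothTransition =ᶠ[𝓝 x] fun _ => 1 := by
    filter_upwards [Ioi_mem_nhds hx] with y hy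
    exact Real.smoothTransition.one_of_one_le (le_of_lt hy)
  rw [this.deriv_eq, deriv_const]

lemma continuous_deriv_smoothTransition : Continuous (deriv Real.smoothTransition) :=
  Real.smoothTransition.contDiff.continuous_deriv (n := ∞) (by simp)

lemma deriv_smoothTransition_scaled (c s x : ℝ) :
    deriv (fun t => Real.smoothTransition (c * (t - s))) x =
      c * deriv Real.smoothTransition (c * (x - s)) := by
  have h1 : HasDerivAt Real.smoothTransition (deriv Real.smoothTransition (c * (x - s)))
      (c * (x - s)) :=
    ((Real.smoothTransition.contDiff (n := ⊤)).differentiable (by simp) _).hasDerivAt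
  have h2 : HasDerivAt (fun t => c * (t - s)) c x := by
    simpa using ((hasDerivAt_id x).sub_const s).const_mul c
  rw [mul_comm]
  exact (h1.comp x h2).deriv

/-- The derivatives of the steps `smoothTransition (n (· - s))` form an approximate identity
concentrated on the right of `s`. -/
lemma tendsto_integral_deriv_smoothTransition {u : ℝ → ℝ} {s : ℝ} {A : Set ℝ}
    (hA : MeasurableSet A) (hu : ContinuousOn u A) (hs : A ∈ 𝓝 s) :
    Tendsto (fun n : ℕ => ∫ t in A, (n * deriv Real.smoothTransition (n * (t - s))) * u t) atTop
      (𝓝 (u s)) := by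
  obtain ⟨δ, hδ, hball⟩ := Metric.nhds_basis_closedBall.mem_iff.1 hs
  have hsub : Icc s (s + δ) ⊆ A := fun x hx => hball (by
    rw [Metric.mem_closedBall, Real.dist_eq, abs_le]; constructor <;> linarith [hx.1, hx.2])
  have hS1 : ∫ x in (0:ℝ)..1, deriv Real.smoothTransition x = 1 := by
    rw [intervalIntegral.integral_deriv_eq_sub
      (fun x _ => (Real.smoothTransition.contDiff (n := ⊤)).differentiable (by simp) x)
      (continuous_deriv_smoothTransition.intervalIntegrable _ _)]
    simp [Real.smoothTransition.one_of_one_le]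
  obtain ⟨K, hK⟩ := (isCompact_Icc (a := (0:ℝ)) (b := 1)).exists_bound_of_continuousOn
    continuous_deriv_smoothTransition.continuousOn
  obtain ⟨M, hM⟩ := (isCompact_Icc (a := s) (b := s + δ)).exists_bound_of_continuousOn
    (hu.mono hsub)
  have hcA : ContinuousAt u s := hu.continuousAt hs
  obtain ⟨m, hm⟩ := exists_nat_gt (1 / δ)
  have hm0 : 0 < (m : ℝ) := (by positivity : (0:ℝ) < 1 / δ).trans hm
  have key : ∀ᶠ n : ℕ in atTop,
      ∫ t in A, (n * deriv Real.smoothTransition (n * (t - s))) * u t =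
      ∫ x in (0:ℝ)..1, deriv Real.smoothTransition x * u (s + x / n) := by
    filter_upwards [eventually_ge_atTop m] with n hn
    have hmn : (m : ℝ) ≤ n := by exact_mod_cast hn
    have hn0 : (0:ℝ) < n := hm0.trans_le hmn
    have hnδ : 1 / (n:ℝ) ≤ δ := by
      rw [div_lt_iff₀ hδ] at hm
      rw [div_le_iff₀ hn0]; nlinarith
    have h1 : ∫ t in A, (n * deriv Real.smoothTransition (n * (t - s))) * u t =
        ∫ t in Icc s (s + 1 / n), (n * deriv Real.smoothTransition (n * (t - s))) * u t := by
      apply setIntegral_eq_of_subset_of_forall_sdiff_eq_zero hA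
      · exact fun x hx => hsub ⟨hx.1, hx.2.trans (by linarith)⟩
      · rintro x ⟨_, hx⟩
        have : deriv Real.smoothTransition (n * (x - s)) = 0 := by
          rcases lt_or_ge x s with h | h
          · exact deriv_smoothTransition_eq_zero_of_neg
              (mul_neg_of_pos_of_neg hn0 (by linarith))
          · apply deriv_smoothTransition_eq_zero_of_one_lt
            have : s + 1 / n < x := by
              by_contra! h'
              exact hx ⟨h, h'⟩
            have h2 : 1 / (n:ℝ) < x - s := by linarith
            rw [div_lt_iff₀ hn0] at h2
            linarith
        rw [this]; ring
    rw [h1, integral_Icc_eq_integral_Ioc, ← intervalIntegral.integral_of_le (by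
      have : 0 < 1 / (n:ℝ) := by positivity
      linarith)]
    have h2 := intervalIntegral.integral_comp_mul_deriv' (a := (0:ℝ)) (b := 1)
      (f := fun x => s + x / n) (f' := fun _ => 1 / (n:ℝ))
      (g := fun t => (n * deriv Real.smoothTransition (n * (t - s))) * u t)
      (fun x _ => by
        have := ((hasDerivAt_id x).div_const (n:ℝ)).const_add s
        simpa using this) continuousOn_const (by
        apply ContinuousOn.mul
        · exact (continuous_const.mul (continuous_deriv_smoothTransition.comp
            (by fun_prop))).continuousOn
        · apply hu.mono
          rintro _ ⟨x, hx, rfl⟩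
          rw [uIcc_of_le zero_le_one] at hx
          apply hsub
          constructor
          · have := div_nonneg hx.1 hn0.le
            simp only; linarith
          · have : x / n ≤ 1 / n := by gcongr; exact hx.2
            simp only; linarith)
    simp only [Function.comp_def, zero_div, add_zero] at h2
    rw [← h2]
    apply intervalIntegral.integral_congr
    intro x _
    have : (n:ℝ) * (s + x / n - s) = x := by field_simp; ring
    simp only [this]
    field_simp
  rw [tendsto_congr' key]
  have hlim : (u s) = ∫ x in (0:ℝ)..1, deriv Real.smoothTransition x * u s := by
    rw [intervalIntegral.integral_mul_const, hS1, one_mul]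
  rw [hlim]
  have hmemI : ∀ᶠ n : ℕ in atTop, ∀ x ∈ Ioc (0:ℝ) 1, s + x / n ∈ Icc s (s + δ) := by
    filter_upwards [eventually_ge_atTop m] with n hn x hx
    have hmn : (m : ℝ) ≤ n := by exact_mod_cast hn
    have hn0 : (0:ℝ) < n := hm0.trans_le hmn
    have hnδ : x / (n:ℝ) ≤ δ := by
      rw [div_lt_iff₀ hδ] at hm
      rw [div_le_iff₀ hn0]; nlinarith [hx.2]
    have := div_nonneg hx.1.le hn0.le
    exact ⟨by linarith, by linarith⟩
  apply intervalIntegral.tendsto_integral_filter_of_dominated_convergence (fun _ => K * M)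
  · filter_upwards [hmemI] with n hn
    rw [uIoc_of_le zero_le_one]
    apply ContinuousOn.aestronglyMeasurable _ measurableSet_Ioc
    apply continuous_deriv_smoothTransition.continuousOn.mul
    exact (hu.mono hsub).comp (by fun_prop) hn
  · filter_upwards [hmemI] with n hn
    refine .of_forall fun x hx => ?_
    rw [uIoc_of_le zero_le_one] at hx
    rw [norm_mul]
    exact mul_le_mul (hK x ⟨hx.1.le, hx.2⟩) (hM _ (hn x hx)) (norm_nonneg _)
      ((norm_nonneg _).trans (hK x ⟨hx.1.le, hx.2⟩))
  · simp
  · refine .of_forall fun x _ => ?_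
    apply tendsto_const_nhds.mul
    apply hcA.tendsto.comp
    have := (tendsto_const_div_atTop_nhds_zero_nat x).const_add s
    simpa using this

/-- A continuous function on `[0,T]` whose distributional derivative on `(0,T)` is an integrable
function is the primitive of that function. -/
lemma sub_eq_integral_of_weakDeriv {T : ℝ} {u η : ℝ → ℝ} (hu : ContinuousOn u (Icc 0 T))
    (hη : IntegrableOn η (Ioo 0 T))
    (h : ∀ φ : ℝ → ℝ, ContDiff ℝ ∞ φ → HasCompactSupport φ → tsupport φ ⊆ Ioo 0 T →
      ∫ t in Ioo 0 T, deriv φ t * u t = -∫ t in Ioo 0 T, φ t * η t)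
    {s t : ℝ} (hs : 0 ≤ s) (hst : s ≤ t) (ht : t ≤ T) :
    u t - u s = ∫ τ in s..t, η τ := by
  -- interior times: the test functions are smooth approximations of the indicator of `(s, t]`
  have inner : ∀ s t : ℝ, 0 < s → s ≤ t → t < T → u t - u s = ∫ τ in s..t, η τ := by
    intro s t hs hst ht
    let φ : ℕ → ℝ → ℝ := fun n x =>
      Real.smoothTransition (n * (x - s)) - Real.smoothTransition (n * (x - t))
    have hφs : ∀ n, ContDiff ℝ ∞ (φ n) := fun n =>
      (Real.smoothTransition.contDiff.comp (by fun_prop)).sub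
        (Real.smoothTransition.contDiff.comp (by fun_prop))
    have hd : ∀ n x, deriv (φ n) x = n * deriv Real.smoothTransition (n * (x - s)) -
        n * deriv Real.smoothTransition (n * (x - t)) := by
      intro n x
      have hdd : ∀ r : ℝ, DifferentiableAt ℝ
          (fun x : ℝ => Real.smoothTransition ((n:ℝ) * (x - r))) x := fun r =>
        ((Real.smoothTransition.contDiff (n := ⊤)).comp
          (by fun_prop : ContDiff ℝ ∞ fun x : ℝ => (n:ℝ) * (x - r))).differentiable (by simp) x
      change deriv (fun x => Real.smoothTransition ((n:ℝ) * (x - s)) -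
        Real.smoothTransition ((n:ℝ) * (x - t))) x = _
      rw [deriv_fun_sub (hdd s) (hdd t), deriv_smoothTransition_scaled,
        deriv_smoothTransition_scaled]
    obtain ⟨m, hm⟩ := exists_nat_gt (1 / (T - t))
    have hTt : 0 < T - t := by linarith
    have hm0 : 0 < (m : ℝ) := (by positivity : (0:ℝ) < 1 / (T - t)).trans hm
    have hsupp : ∀ n ≥ m, tsupport (φ n) ⊆ Icc s (t + 1 / n) := by
      intro n hn
      have hmn : (m : ℝ) ≤ n := by exact_mod_cast hn
      have hn0 : (0:ℝ) < n := hm0.trans_le hmn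
      apply closure_minimal _ isClosed_Icc
      intro x hx
      rw [Function.mem_support] at hx
      by_contra hx'
      apply hx
      simp only [φ]
      rcases lt_or_ge x s with h1 | h1
      · rw [Real.smoothTransition.zero_of_nonpos, Real.smoothTransition.zero_of_nonpos, sub_zero]
        · exact mul_nonpos_of_nonneg_of_nonpos hn0.le (by linarith)
        · exact mul_nonpos_of_nonneg_of_nonpos hn0.le (by linarith)
      · have h2 : t + 1 / n < x := by
          by_contra! h'
          exact hx' ⟨h1, h'⟩
        have h3 : 1 / (n:ℝ) < x - t := by linarith
        rw [div_lt_iff₀ hn0] at h3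
        rw [Real.smoothTransition.one_of_one_le, Real.smoothTransition.one_of_one_le, sub_self]
        · linarith
        · nlinarith
    have hsub : ∀ n ≥ m, Icc s (t + 1 / n) ⊆ Ioo 0 T := by
      intro n hn x hx
      have hmn : (m : ℝ) ≤ n := by exact_mod_cast hn
      have hn0 : (0:ℝ) < n := hm0.trans_le hmn
      have : 1 / (n:ℝ) < T - t := by
        rw [div_lt_iff₀ hTt] at hm
        rw [div_lt_iff₀ hn0]; nlinarith
      exact ⟨by linarith [hx.1], by linarith [hx.2]⟩
    have hui : ContinuousOn u (Ioo 0 T) := hu.mono Ioo_subset_Icc_self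
    have eqn : ∀ n ≥ m, (∫ x in Ioo 0 T, (n * deriv Real.smoothTransition (n * (x - s))) * u x) -
        (∫ x in Ioo 0 T, (n * deriv Real.smoothTransition (n * (x - t))) * u x) =
        -∫ x in Ioo 0 T, φ n x * η x := by
      intro n hn
      rw [← h (φ n) (hφs n) (isCompact_Icc.of_isClosed_subset (isClosed_tsupport _) (hsupp n hn))
        ((hsupp n hn).trans (hsub n hn)), ← integral_sub]
      · apply integral_congr_ae
        filter_upwards with x
        rw [hd]; ring
      all_goals
        apply IntegrableOn.mono_set _ Ioo_subset_Icc_self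
        apply ContinuousOn.integrableOn_Icc
        exact (continuous_const.mul (continuous_deriv_smoothTransition.comp
            (by fun_prop))).continuousOn.mul hu
    have lim1 := (tendsto_integral_deriv_smoothTransition measurableSet_Ioo hui
        (Ioo_mem_nhds hs (by linarith : s < T))).sub
      (tendsto_integral_deriv_smoothTransition measurableSet_Ioo hui
        (Ioo_mem_nhds (by linarith : 0 < t) ht))
    have lim2 : Tendsto (fun n : ℕ => -∫ x in Ioo 0 T, φ n x * η x) atTop
        (𝓝 (-∫ x in Ioo 0 T, ((Ioc s t).indicator (fun _ => (1:ℝ)) x) * η x)) := by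
      apply Tendsto.neg
      apply tendsto_integral_of_dominated_convergence (fun x => |η x|)
      · intro n
        exact ((hφs n).continuous.aestronglyMeasurable).mul hη.aestronglyMeasurable
      · exact hη.abs
      · intro n
        refine .of_forall fun x => ?_
        rw [norm_mul]
        refine (mul_le_of_le_one_left (norm_nonneg _) ?_)
        rw [Real.norm_eq_abs, abs_le]
        have a1 := Real.smoothTransition.nonneg (n * (x - s))
        have a2 := Real.smoothTransition.nonneg (n * (x - t))
        have a3 := Real.smoothTransition.le_one (n * (x - s))
        have a4 := Real.smoothTransition.le_one (n * (x - t))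
        constructor <;> simp only [φ] <;> linarith
      · refine .of_forall fun x => ?_
        apply Tendsto.mul_const
        have := (tendsto_smoothTransition_mul (x - s)).sub (tendsto_smoothTransition_mul (x - t))
        convert this using 2
        simp only [indicator, mem_Ioc, mem_Ioi, sub_pos]
        by_cases h1 : s < x <;> by_cases h2 : t < x <;> simp [h1, h2]
        · linarith
    have := tendsto_nhds_unique (lim1.congr' (by
      filter_upwards [eventually_ge_atTop m] with n hn using eqn n hn)) lim2
    have h3 : ∫ x in Ioo 0 T, ((Ioc s t).indicator (fun _ => (1:ℝ)) x) * η x =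
        ∫ τ in s..t, η τ := by
      rw [intervalIntegral.integral_of_le hst]
      have : (fun x => ((Ioc s t).indicator (fun _ => (1:ℝ)) x) * η x) = (Ioc s t).indicator η := by
        ext x; by_cases hx : x ∈ Ioc s t <;> simp [hx]
      rw [this, setIntegral_indicator measurableSet_Ioc, inter_eq_self_of_subset_right]
      exact fun x hx => ⟨hs.trans hx.1, hx.2.trans_lt ht⟩
    rw [h3] at this
    linarith
  -- endpoints, by continuity
  rcases hst.eq_or_lt with rfl | hlt
  · simp
  have hηi : IntervalIntegrable η volume 0 T := by
    rw [intervalIntegrable_iff_integrableOn_Ioo_of_le (hs.trans (hst.trans ht))]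
    exact hη
  have h0T : (0:ℝ) ≤ T := hs.trans (hst.trans ht)
  have hP : ContinuousOn (fun t => ∫ τ in (0:ℝ)..t, η τ) (Icc 0 T) := by
    have := intervalIntegral.continuousOn_primitive_interval' hηi left_mem_uIcc
    rwa [uIcc_of_le h0T] at this
  set d : ℝ → ℝ := fun t => u t - ∫ τ in (0:ℝ)..t, η τ with hdd
  have hd : ContinuousOn d (Icc 0 T) := hu.sub hP
  have hii : ∀ a b : ℝ, 0 ≤ a → a ≤ T → 0 ≤ b → b ≤ T → IntervalIntegrable η volume a b := by
    intro a b ha ha' hb hb'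
    apply hηi.mono_set
    rw [uIcc_of_le h0T]
    exact uIcc_subset_Icc ⟨ha, ha'⟩ ⟨hb, hb'⟩
  have hconst : ∀ x ∈ Ioo 0 T, ∀ y ∈ Ioo 0 T, x ≤ y → d x = d y := by
    intro x hx y hy hxy
    have := inner x y hx.1 hxy hy.2
    have h2 := intervalIntegral.integral_add_adjacent_intervals
      (hii 0 x le_rfl h0T hx.1.le hx.2.le) (hii x y hx.1.le hx.2.le hy.1.le hy.2.le)
    simp only [hdd]; linarith
  have h0T' : (0:ℝ) < T := by linarith
  have hcl : ∀ x ∈ Icc 0 T, d x = d (T / 2) := by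
    have hE : EqOn d (fun _ => d (T / 2)) (Ioo 0 T) := by
      intro x hx
      have hm : T / 2 ∈ Ioo 0 T := ⟨by linarith, by linarith⟩
      rcases le_total x (T / 2) with h | h
      · exact hconst x hx _ hm h
      · exact (hconst _ hm x hx h).symm
    apply hE.of_subset_closure hd continuousOn_const Ioo_subset_Icc_self
    rw [closure_Ioo h0T'.ne]
  have e1 := hcl s ⟨hs, hst.trans ht⟩
  have e2 := hcl t ⟨hs.trans hst, ht⟩
  have h2 := intervalIntegral.integral_add_adjacent_intervals
      (hii 0 s le_rfl h0T hs (hst.trans ht)) (hii s t hs (hst.trans ht) (hs.trans hst) ht)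
  simp only [hdd] at e1 e2
  linarith

/-! ### The energy method -/

section Energy

variable {A Y H : Type*} [NormedAddCommGroup A] [NormedSpace ℝ A] [NormedAddCommGroup Y]
  [NormedSpace ℝ Y] [NormedAddCommGroup H] [InnerProductSpace ℝ H]

/-- Translation in time is continuous on `L^q(ℝ)`, hence so are the translated pairings. -/
lemma continuous_integral_translate {p q : ℝ≥0∞} [Fact (1 ≤ p)] [Fact (1 ≤ q)]
    [q.HolderConjugate p] (hq : q ≠ ⊤) (B : A →L[ℝ] Y →L[ℝ] ℝ) {G : ℝ → A} {y : ℝ → Y}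
    (hG : MemLp G q volume) (hy : MemLp y p volume) :
    Continuous fun σ : ℝ => ∫ r, B (G (r - σ)) (y r) := by
  have : Fact (q ≠ ⊤) := ⟨hq⟩
  have h : (fun σ : ℝ => ∫ r, B (G (r - σ)) (y r)) = fun σ : ℝ =>
      B.lpPairing volume q p (DomAddAct.mk (-σ) +ᵥ hG.toLp) (hy.toLp) := by
    ext σ
    rw [ContinuousLinearMap.lpPairing_eq_integral, DomAddAct.mk_vadd_toLp]
    apply integral_congr_ae
    filter_upwards [hy.coeFn_toLp,
      (hG.comp_measurePreserving (measurePreserving_vadd (-σ) volume)).coeFn_toLp] with r h1 h2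
    rw [h1]
    erw [h2]
    simp [sub_eq_neg_add]
  rw [h]
  have hc : Continuous fun σ : ℝ => (DomAddAct.mk (-σ) +ᵥ hG.toLp : Lp A q (volume : Measure ℝ)) :=
    (DomAddAct.continuous_mk.comp continuous_neg).vadd continuous_const
  exact ((B.lpPairing volume q p).continuous.comp hc).clm_apply continuous_const

/-- Fubini for the translated pairings, averaged over the translations by `σ ∈ (0,h)`. -/
lemma integral_translate_swap {p q : ℝ≥0∞} [Fact (1 ≤ p)] [Fact (1 ≤ q)]
    [q.HolderConjugate p] (hq : q ≠ ⊤) {G : ℝ → Y →L[ℝ] ℝ} {y : ℝ → Y}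
    (hG : MemLp G q volume) (hy : MemLp y p volume) {h : ℝ} (hh : 0 ≤ h) :
    Integrable (fun r => ∫ σ in (0:ℝ)..h, G (r - σ) (y r)) volume ∧
      ∫ σ in (0:ℝ)..h, ∫ r, G (r - σ) (y r) = ∫ r, ∫ σ in (0:ℝ)..h, G (r - σ) (y r) := by
  have ψnc : Continuous fun σ : ℝ => ∫ r, ‖G (r - σ)‖ * ‖y r‖ :=
    continuous_integral_translate hq (ContinuousLinearMap.mul ℝ ℝ) hG.norm hy.norm
  have hqmp : Measure.QuasiMeasurePreserving (fun z : ℝ × ℝ => z.2 - z.1)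
      ((volume : Measure ℝ).prod volume) volume :=
    (quasiMeasurePreserving_sub volume volume).comp
      Measure.measurePreserving_swap.quasiMeasurePreserving
  have meas : AEStronglyMeasurable (fun z : ℝ × ℝ => G (z.2 - z.1) (y z.2))
      ((volume.restrict (Ioc 0 h)).prod volume) := by
    have hac : (volume.restrict (Ioc 0 h)).prod (volume : Measure ℝ) ≪
        (volume : Measure ℝ).prod volume :=
      Measure.AbsolutelyContinuous.prod Measure.absolutelyContinuous_restrict .rfl
    apply AEStronglyMeasurable.mono_ac hac
    exact (ContinuousLinearMap.id ℝ (Y →L[ℝ] ℝ)).aestronglyMeasurable_comp₂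
      (hG.1.comp_quasiMeasurePreserving hqmp) hy.1.comp_snd
  have bd : ∀ σ r, ‖G (r - σ) (y r)‖ ≤ ‖G (r - σ)‖ * ‖y r‖ := fun σ r =>
    ContinuousLinearMap.le_opNorm _ _
  have mGσ : ∀ σ, MemLp (fun r => G (r - σ)) q volume := fun σ =>
    hG.comp_measurePreserving (measurePreserving_sub_right volume σ)
  have intn : ∀ σ, Integrable (fun r => ‖G (r - σ)‖ * ‖y r‖) volume := fun σ =>
    MemLp.integrable_mul (mGσ σ).norm hy.norm
  have int1 : ∀ σ, Integrable (fun r => G (r - σ) (y r)) volume := fun σ =>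
    (intn σ).mono' ((ContinuousLinearMap.id ℝ (Y →L[ℝ] ℝ)).aestronglyMeasurable_comp₂
      (mGσ σ).1 hy.1) (.of_forall (bd σ))
  have int2 : Integrable (fun z : ℝ × ℝ => G (z.2 - z.1) (y z.2))
      ((volume.restrict (Ioc 0 h)).prod volume) := by
    rw [integrable_prod_iff meas]
    refine ⟨.of_forall int1, ?_⟩
    refine Integrable.mono' (g := fun σ => ∫ r, ‖G (r - σ)‖ * ‖y r‖)
      (ψnc.integrableOn_Ioc) meas.norm.integral_prod_right' (.of_forall fun σ => ?_)
    rw [Real.norm_of_nonneg (integral_nonneg fun _ => norm_nonneg _)]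
    exact integral_mono (int1 σ).norm (intn σ) (bd σ)
  simp only [intervalIntegral.integral_of_le hh]
  exact ⟨int2.integral_prod_right, integral_integral_swap int2⟩

/-- The energy inequality on the whole time axis. The increment `‖W r‖² - ‖W (r - h)‖²` is at most
`2 ⟪W r - W (r - h), W r⟫`; averaging in time and letting `h → 0` needs only the continuity of
translations in `L^q`, and no differentiability of `W`. -/
lemma norm_sq_le_integral_pairing {s : ℝ} {p q : ℝ≥0∞} [Fact (1 ≤ p)] [Fact (1 ≤ q)]
    [q.HolderConjugate p] (hq : q ≠ ⊤) {W : ℝ → H} {y : ℝ → Y} {G : ℝ → Y →L[ℝ] ℝ}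
    (hs : 0 ≤ s) (hW : Continuous W) (hneg : ∀ t ≤ 0, W t = 0)
    (hG : MemLp G q volume) (hy : MemLp y p volume) (hys : ∀ r ∉ Ioo 0 s, y r = 0)
    (heq : ∀ᵐ r ∂(volume.restrict (Ioo 0 s)), ∀ h > 0,
      inner ℝ (W r - W (r - h)) (W r) = ∫ τ in (r - h)..r, G τ (y r)) :
    ‖W s‖ ^ 2 ≤ 2 * ∫ r, G r (y r) := by
  set ψ : ℝ → ℝ := fun σ => ∫ r, G (r - σ) (y r) with hψ
  have ψc : Continuous ψ :=
    continuous_integral_translate hq (ContinuousLinearMap.id ℝ (Y →L[ℝ] ℝ)) hG hy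
  have cW : Continuous fun r => ‖W r‖ ^ 2 := by fun_prop
  have step : ∀ h > 0, ∫ r in (s - h)..s, ‖W r‖ ^ 2 ≤ 2 * ∫ σ in (0:ℝ)..h, ψ σ := by
    intro h hh
    obtain ⟨int3, swap⟩ := integral_translate_swap hq hG hy hh.le
    have outside : ∀ r ∉ Ioo 0 s, ∫ σ in (0:ℝ)..h, G (r - σ) (y r) = 0 := by
      intro r hr
      simp [hys r hr]
    have swap2 : ∫ σ in (0:ℝ)..h, ψ σ = ∫ r in Ioo 0 s, ∫ σ in (0:ℝ)..h, G (r - σ) (y r) := by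
      rw [swap, setIntegral_eq_integral_of_forall_compl_eq_zero outside]
    have ptw : ∀ᵐ r ∂(volume.restrict (Ioo 0 s)), ‖W r‖ ^ 2 - ‖W (r - h)‖ ^ 2 ≤
        2 * ∫ σ in (0:ℝ)..h, G (r - σ) (y r) := by
      filter_upwards [heq] with r hr
      rw [intervalIntegral.integral_comp_sub_left (fun τ => G τ (y r)) r, sub_zero, ← hr h hh]
      have := norm_sub_sq_real (W r) (W (r - h))
      have e3 : inner ℝ (W r - W (r - h)) (W r) =
          ‖W r‖ ^ 2 - inner ℝ (W r) (W (r - h)) := by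
        rw [inner_sub_left, real_inner_self_eq_norm_sq, real_inner_comm]
      rw [e3]
      nlinarith [sq_nonneg ‖W r - W (r - h)‖]
    have cWh : Continuous fun r => ‖W (r - h)‖ ^ 2 := by fun_prop
    have mono : ∫ r in Ioo 0 s, (‖W r‖ ^ 2 - ‖W (r - h)‖ ^ 2) ≤
        ∫ r in Ioo 0 s, 2 * ∫ σ in (0:ℝ)..h, G (r - σ) (y r) :=
      integral_mono_ae
        ((cW.sub cWh).integrableOn_Icc.mono_set Ioo_subset_Icc_self)
        (int3.integrableOn.const_mul 2) ptw
    rw [integral_const_mul, ← swap2] at mono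
    refine le_trans (le_of_eq ?_) mono
    rw [← integral_Ioc_eq_integral_Ioo, ← intervalIntegral.integral_of_le hs,
      intervalIntegral.integral_sub (cW.intervalIntegrable _ _) (cWh.intervalIntegrable _ _),
      intervalIntegral.integral_comp_sub_right (fun r => ‖W r‖ ^ 2) h]
    have z : ∫ r in (0 - h)..0, ‖W r‖ ^ 2 = 0 := by
      rw [intervalIntegral.integral_congr (g := fun _ => (0:ℝ)), intervalIntegral.integral_zero]
      intro r hr
      rw [uIcc_of_le (by linarith)] at hr
      simp [hneg r hr.2]
    have a1 := intervalIntegral.integral_add_adjacent_intervals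
      (cW.intervalIntegrable (μ := volume) (0 - h) 0) (cW.intervalIntegrable 0 s)
    have a2 := intervalIntegral.integral_add_adjacent_intervals
      (cW.intervalIntegrable (μ := volume) (0 - h) (s - h)) (cW.intervalIntegrable (s - h) s)
    linarith
  have d1 : HasDerivAt (fun h => ∫ r in (s - h)..s, ‖W r‖ ^ 2) (‖W s‖ ^ 2) 0 := by
    have e1 : HasDerivAt (fun u => ∫ r in u..s, ‖W r‖ ^ 2) (-‖W s‖ ^ 2) (s - 0) := by
      rw [sub_zero]
      exact intervalIntegral.integral_hasDerivAt_left (cW.intervalIntegrable _ _)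
        (cW.stronglyMeasurableAtFilter _ _) cW.continuousAt
    have e2 : HasDerivAt (fun h : ℝ => s - h) (-1) 0 := by
      simpa using (hasDerivAt_id (0:ℝ)).const_sub s
    have e3 := HasDerivAt.comp (0:ℝ) e1 e2
    rw [neg_mul_neg, mul_one] at e3
    exact e3
  have d2 : HasDerivAt (fun h => 2 * ∫ σ in (0:ℝ)..h, ψ σ) (2 * ψ 0) 0 :=
    (intervalIntegral.integral_hasDerivAt_right (ψc.intervalIntegrable _ _)
      (ψc.stronglyMeasurableAtFilter _ _) ψc.continuousAt).const_mul 2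
  have hψ0 : ψ 0 = ∫ r, G r (y r) := by simp only [hψ, sub_zero]
  rw [← hψ0]
  refine le_of_tendsto_of_tendsto d1.tendsto_slope_zero_right d2.tendsto_slope_zero_right ?_
  filter_upwards [self_mem_nhdsWithin] with h hh
  have hh : 0 < h := hh
  simp only [zero_add, sub_zero, intervalIntegral.integral_same, mul_zero, smul_eq_mul]
  exact mul_le_mul_of_nonneg_left (step h hh) (inv_nonneg.2 hh.le)

/-- The energy inequality on `[0,T]`, from the one on `ℝ`: `W` is extended by constants, and `G` and
`y` by zero. -/
lemma norm_sq_le_integral_norm_sq {T s L : ℝ} {p q : ℝ≥0∞} [Fact (1 ≤ p)] [Fact (1 ≤ q)]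
    [q.HolderConjugate p] (hq : q ≠ ⊤) {W : ℝ → H} {y : ℝ → Y} {G : ℝ → Y →L[ℝ] ℝ}
    (hs : 0 ≤ s) (hsT : s ≤ T)
    (hW : ContinuousOn W (Icc 0 T)) (h0 : W 0 = 0)
    (hG : MemLp G q (volume.restrict (Ioo 0 T))) (hy : MemLp y p (volume.restrict (Ioo 0 T)))
    (heq : ∀ᵐ r ∂(volume.restrict (Ioo 0 T)), ∀ s t, 0 ≤ s → s ≤ t → t ≤ T →
      inner ℝ (W t - W s) (W r) = ∫ τ in s..t, G τ (y r))
    (hle : ∀ᵐ t ∂(volume.restrict (Ioo 0 T)), G t (y t) ≤ L * ‖W t‖ ^ 2) :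
    ‖W s‖ ^ 2 ≤ 2 * ∫ t in (0:ℝ)..s, L * ‖W t‖ ^ 2 := by
  have hT : 0 ≤ T := hs.trans hsT
  -- the data are extended to the whole time axis
  let G' : ℝ → Y →L[ℝ] ℝ := (Ioo 0 T).indicator G
  let y' : ℝ → Y := (Ioo 0 s).indicator y
  let W' : ℝ → H := fun t => W (projIcc 0 T hT t)
  have W'c : Continuous W' := hW.comp_continuous
    (continuous_subtype_val.comp continuous_projIcc) fun t => (projIcc 0 T hT t).2
  have W'eq : ∀ t ∈ Icc 0 T, W' t = W t := fun t ht => by simp [W', projIcc_of_mem hT ht]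
  have W'neg : ∀ t ≤ 0, W' t = 0 := fun t ht => by simp [W', projIcc_of_le_left hT ht, h0]
  have mG : MemLp G' q volume := by
    refine (memLp_indicator_iff_restrict (s := Ioo 0 T) (f := G) measurableSet_Ioo).2 ?_
    exact hG
  have my : MemLp y' p volume := by
    refine (memLp_indicator_iff_restrict (s := Ioo 0 s) (f := y) measurableSet_Ioo).2 ?_
    exact hy.mono_measure (Measure.restrict_mono (Ioo_subset_Ioo_right hsT) le_rfl)
  have y'out : ∀ r ∉ Ioo 0 s, y' r = 0 := fun r hr => indicator_of_notMem hr _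
  have gen : ∀ (z : Y) (a b : ℝ), 0 ≤ a → a ≤ b → b ≤ T →
      ∫ τ in a..b, G' τ z = ∫ τ in a..b, G τ z := by
    intro z a b ha hab hb
    rw [intervalIntegral.integral_of_le hab, intervalIntegral.integral_of_le hab,
      integral_Ioc_eq_integral_Ioo, integral_Ioc_eq_integral_Ioo]
    refine setIntegral_congr_fun measurableSet_Ioo fun τ hτ => ?_
    simp only [G']
    have hτ' : τ ∈ Ioo 0 T := ⟨ha.trans_lt hτ.1, hτ.2.trans_le hb⟩
    rw [indicator_of_mem hτ']
  have main := norm_sq_le_integral_pairing hq hs W'c W'neg mG my y'out (by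
    filter_upwards [ae_restrict_of_ae_restrict_of_subset (Ioo_subset_Ioo_right hsT) heq,
      ae_restrict_mem measurableSet_Ioo] with r hr hrs
    intro h hh
    have hy'r : y' r = y r := indicator_of_mem hrs _
    have hrT : r ∈ Icc 0 T := ⟨hrs.1.le, hrs.2.le.trans hsT⟩
    rw [hy'r]
    rcases le_total 0 (r - h) with h1 | h1
    · rw [gen _ _ _ h1 (by linarith) hrT.2, ← hr _ _ h1 (by linarith) hrT.2,
        W'eq r hrT, W'eq (r - h) ⟨h1, by linarith [hrT.2]⟩]
    · have e2 : ∫ τ in (r - h)..r, G' τ (y r) = ∫ τ in (0:ℝ)..r, G' τ (y r) := by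
        rw [intervalIntegral.integral_of_le (by linarith : r - h ≤ r),
          intervalIntegral.integral_of_le hrT.1]
        apply setIntegral_eq_of_subset_of_forall_sdiff_eq_zero measurableSet_Ioc
        · exact Ioc_subset_Ioc_left h1
        · rintro τ ⟨h2, h3⟩
          have : G' τ = 0 := indicator_of_notMem (fun h4 => h3 ⟨h4.1, h2.2⟩) _
          rw [this, zero_apply]
      rw [e2, gen _ _ _ le_rfl hrT.1 hrT.2, ← hr _ _ le_rfl hrT.1 hrT.2, W'eq r hrT,
        W'neg _ h1, h0])
  rw [← W'eq s ⟨hs, hsT⟩]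
  refine main.trans (mul_le_mul_of_nonneg_left ?_ zero_le_two)
  have hψ0 : ∫ r, G' r (y' r) = ∫ r in Ioo 0 s, G' r (y' r) := by
    rw [setIntegral_eq_integral_of_forall_compl_eq_zero]
    intro r hr
    rw [y'out r hr, map_zero]
  rw [hψ0, intervalIntegral.integral_of_le hs, integral_Ioc_eq_integral_Ioo]
  have intG : Integrable (fun r => G' r (y' r)) volume :=
    (MemLp.integrable_mul mG.norm my.norm).mono'
      ((ContinuousLinearMap.id ℝ (Y →L[ℝ] ℝ)).aestronglyMeasurable_comp₂ mG.1 my.1)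
      (.of_forall fun r => ContinuousLinearMap.le_opNorm _ _)
  refine integral_mono_ae intG.integrableOn ?_ ?_
  · refine IntegrableOn.mono_set ?_ Ioo_subset_Icc_self
    apply ContinuousOn.integrableOn_Icc
    exact continuousOn_const.mul ((hW.mono (Icc_subset_Icc_right hsT)).norm.pow 2)
  · filter_upwards [ae_restrict_of_ae_restrict_of_subset (Ioo_subset_Ioo_right hsT) hle,
      ae_restrict_mem measurableSet_Ioo] with r hr hrs
    simp only [G', y']
    rw [indicator_of_mem hrs, indicator_of_mem (Ioo_subset_Ioo_right hsT hrs)]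
    exact hr

/-- The energy method for a curve `W` in a Hilbert space with `W 0 = 0`, whose increments are given
by an `L^q`-path of functionals `G` when tested with `W r` itself. The points `y r` carry the
additional component (here a gradient) that `G` sees but the Hilbert space does not. -/
lemma eq_zero_of_energy {T L : ℝ} {p q : ℝ≥0∞} [Fact (1 ≤ p)] [Fact (1 ≤ q)]
    [q.HolderConjugate p] (hq : q ≠ ⊤) {W : ℝ → H} {y : ℝ → Y} {G : ℝ → Y →L[ℝ] ℝ}
    (hL : 0 ≤ L) (hW : ContinuousOn W (Icc 0 T)) (h0 : W 0 = 0)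
    (hG : MemLp G q (volume.restrict (Ioo 0 T))) (hy : MemLp y p (volume.restrict (Ioo 0 T)))
    (heq : ∀ᵐ r ∂(volume.restrict (Ioo 0 T)), ∀ s t, 0 ≤ s → s ≤ t → t ≤ T →
      inner ℝ (W t - W s) (W r) = ∫ τ in s..t, G τ (y r))
    (hle : ∀ᵐ t ∂(volume.restrict (Ioo 0 T)), G t (y t) ≤ L * ‖W t‖ ^ 2) :
    ∀ t ∈ Icc 0 T, W t = 0 := by
  intro t ht
  have hT : 0 ≤ T := ht.1.trans ht.2
  have main : ∀ s ∈ Icc 0 T, ‖W s‖ ^ 2 ≤ 2 * L * ∫ r in (0:ℝ)..s, ‖W r‖ ^ 2 := by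
    intro s hs
    have := norm_sq_le_integral_norm_sq hq hs.1 hs.2 hW h0 hG hy heq hle
    rwa [intervalIntegral.integral_const_mul, ← mul_assoc] at this
  have cW : ContinuousOn (fun r => ‖W r‖ ^ 2) (Icc 0 T) := hW.norm.pow 2
  have ii : ∀ s ∈ Icc 0 T, IntervalIntegrable (fun r => ‖W r‖ ^ 2) volume 0 s := fun s hs => by
    apply ContinuousOn.intervalIntegrable
    rw [uIcc_of_le hs.1]
    exact cW.mono (Icc_subset_Icc_right hs.2)
  set I : ℝ → ℝ := fun s => ∫ r in (0:ℝ)..s, ‖W r‖ ^ 2 with hI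
  have I0 : ∀ s ∈ Icc 0 T, 0 ≤ I s := fun s hs =>
    intervalIntegral.integral_nonneg hs.1 fun _ _ => by positivity
  have hgr := norm_le_gronwallBound_of_norm_deriv_right_le (f := I) (f' := fun s => ‖W s‖ ^ 2)
    (δ := 0) (K := 2 * L) (ε := 0) (a := 0) (b := T)
    (by
      have := intervalIntegral.continuousOn_primitive_interval' (ii T ⟨hT, le_rfl⟩) left_mem_uIcc
      rwa [uIcc_of_le hT] at this)
    (by
      intro x hx
      have hx' : x ∈ Icc 0 T := ⟨hx.1, hx.2.le⟩
      have hn : Icc 0 T ∈ 𝓝[>] x := mem_of_superset (Ioo_mem_nhdsGT hx.2)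
        fun z hz => ⟨hx.1.trans hz.1.le, hz.2.le⟩
      have := intervalIntegral.integral_hasDerivWithinAt_right (s := Ici x) (t := Ioi x)
        (ii x hx')
        ⟨Icc 0 T, hn, cW.aestronglyMeasurable measurableSet_Icc⟩
        ((cW x hx').mono_of_mem_nhdsWithin hn)
      exact this)
    (by simp [hI])
    (by
      intro x hx
      have hx' : x ∈ Icc 0 T := ⟨hx.1, hx.2.le⟩
      rw [Real.norm_of_nonneg (by positivity), Real.norm_of_nonneg (I0 x hx'), add_zero]
      exact main x hx')
  have h1 := hgr t ht
  rw [gronwallBound_ε0_δ0, Real.norm_of_nonneg (I0 t ht)] at h1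
  have h2 := main t ht
  have h3 : ‖W t‖ ^ 2 ≤ 0 := h2.trans (mul_nonpos_of_nonneg_of_nonpos (by positivity) h1)
  have h4 : ‖W t‖ = 0 := by
    have := sq_nonneg ‖W t‖
    exact pow_eq_zero_iff two_ne_zero |>.1 (le_antisymm h3 this)
  exact norm_eq_zero.1 h4

end Energy

/-! ### Finiteness of the surface measure -/

section Surface

variable {N : ℕ}

/-- Openness of `Ω` excludes negative values of the defining function on `Γ`, and
`Γ ⊆ closure Ω` excludes positive ones. -/
lemma defining_function_eq_zero {Ω O : Set (E N)} {ρ : E N → ℝ} (hΩo : IsOpen Ω) (hO : IsOpen O)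
    (hρ : Continuous ρ) (h : Ω ∩ O = {y ∈ O | ρ y < 0}) {y : E N} (hy : y ∈ frontier Ω)
    (hyO : y ∈ O) : ρ y = 0 := by
  have hyΩ : y ∉ Ω := by
    rw [hΩo.frontier_eq] at hy
    exact hy.2
  rcases lt_trichotomy (ρ y) 0 with h1 | h1 | h1
  · exact absurd (h.ge ⟨hyO, h1⟩ : y ∈ Ω ∩ O).1 hyΩ
  · exact h1
  · have hV : IsOpen (O ∩ {z | 0 < ρ z}) := hO.inter (isOpen_lt continuous_const hρ)
    obtain ⟨z, ⟨hzO, hz⟩, hzΩ⟩ :=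
      mem_closure_iff.1 (frontier_subset_closure hy) _ hV ⟨hyO, h1⟩
    have := (h.le ⟨hzΩ, hzO⟩ : z ∈ {y ∈ O | ρ y < 0}).2
    exact absurd hz (not_lt.2 this.le)

lemma finrank_ker_of_ne_zero {f : E N →L[ℝ] ℝ} (hf : f ≠ 0) :
    Module.finrank ℝ (LinearMap.ker (f : E N →ₗ[ℝ] ℝ)) = N - 1 := by
  have h1 := LinearMap.finrank_range_add_finrank_ker (f : E N →ₗ[ℝ] ℝ)
  have h2 : LinearMap.range (f : E N →ₗ[ℝ] ℝ) = ⊤ := by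
    apply LinearMap.range_eq_top.2
    apply LinearMap.surjective
    intro h
    apply hf
    ext v
    exact congrArg (fun g : E N →ₗ[ℝ] ℝ => g v) h
  rw [h2, finrank_top, Module.finrank_self, finrank_euclideanSpace_fin] at h1
  omega

/-- Near a zero of `ρ` where its differential does not vanish, the orthogonal projection onto the
kernel of the differential is bi-Lipschitz on the level set `{ρ = 0}`, so this has locally finite
`(N-1)`-dimensional measure. -/
lemma exists_nhds_hausdorffMeasure_lt_top {ρ : E N → ℝ} {x : E N} (hρ : ContDiff ℝ ∞ ρ)
    (hx : fderiv ℝ ρ x ≠ 0) :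
    ∃ U ∈ 𝓝 x, Measure.euclideanHausdorffMeasure (N - 1) (U ∩ {y | ρ y = 0}) < ⊤ := by
  set f := fderiv ℝ ρ x with hf
  let K : Submodule ℝ (E N) := LinearMap.ker (f : E N →ₗ[ℝ] ℝ)
  let P : E N →L[ℝ] K := K.orthogonalProjectionOnto
  let Λ : E N →ₗ[ℝ] K × ℝ := (P : E N →ₗ[ℝ] K).prod (f : E N →ₗ[ℝ] ℝ)
  have hΛ : LinearMap.ker Λ = ⊥ := by
    rw [LinearMap.ker_eq_bot']
    intro v hv
    have h1 : P v = 0 := congrArg Prod.fst hv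
    have h2 : f v = 0 := congrArg Prod.snd hv
    have h3 : v ∈ K := h2
    have h4 : P v = ⟨v, h3⟩ := K.orthogonalProjectionOnto_mem_subspace_eq_self ⟨v, h3⟩
    rw [h4] at h1
    exact congrArg Subtype.val h1
  obtain ⟨C, hC, hanti⟩ := Λ.exists_antilipschitzWith hΛ
  have hCv : ∀ v, ‖v‖ ≤ C * ‖P v‖ + C * ‖f v‖ := by
    intro v
    have := hanti.le_mul_dist v 0
    rw [map_zero, dist_zero_right, dist_zero_right] at this
    refine this.trans ?_
    rw [← mul_add]
    refine mul_le_mul_of_nonneg_left ?_ C.coe_nonneg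
    exact max_le (le_add_of_nonneg_right (norm_nonneg _)) (le_add_of_nonneg_left (norm_nonneg _))
  have hC' : (0:ℝ) < C := by exact_mod_cast hC
  have hstrict : HasStrictFDerivAt ρ f x := (hρ.contDiffAt).hasStrictFDerivAt (by simp)
  have hev := hstrict.isLittleO.def (show (0:ℝ) < 1 / (2 * C) by positivity)
  rw [nhds_prod_eq, eventually_prod_self_iff'] at hev
  obtain ⟨U, hU, hUU⟩ := hev
  refine ⟨U ∩ Metric.ball x 1, inter_mem hU (Metric.ball_mem_nhds x one_pos), ?_⟩
  set S := U ∩ Metric.ball x 1 ∩ {y | ρ y = 0} with hS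
  have hlip : ∀ y ∈ S, ∀ z ∈ S, dist y z ≤ (2 * C : NNReal) * dist (P y) (P z) := by
    intro y hy z hz
    have h1 := hUU y hy.1.1 z hz.1.1
    have h2 : ρ y = 0 := hy.2
    have h3 : ρ z = 0 := hz.2
    simp only [h2, h3, sub_self, zero_sub, norm_neg] at h1
    have h4 := hCv (y - z)
    have h5 : C * ‖f (y - z)‖ ≤ 1 / 2 * ‖y - z‖ := by
      calc C * ‖f (y - z)‖ ≤ C * (1 / (2 * C) * ‖y - z‖) :=
            mul_le_mul_of_nonneg_left h1 hC'.le
        _ = 1 / 2 * ‖y - z‖ := by field_simp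
    rw [dist_eq_norm, dist_eq_norm, ← map_sub]
    push_cast
    linarith
  have hinj : InjOn P S := by
    intro y hy z hz h
    have := hlip y hy z hz
    rw [h, dist_self, mul_zero] at this
    exact dist_le_zero.1 this
  have hg : LipschitzOnWith (2 * C) (Function.invFunOn P S) (P '' S) := by
    apply LipschitzOnWith.of_dist_le_mul
    rintro _ ⟨y, hy, rfl⟩ _ ⟨z, hz, rfl⟩
    rw [hinj.leftInvOn_invFunOn hy, hinj.leftInvOn_invFunOn hz]
    exact hlip y hy z hz
  have himg : Function.invFunOn P S '' (P '' S) = S := hinj.leftInvOn_invFunOn.image_image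
  have hbdd : Bornology.IsBounded (P '' S) :=
    P.lipschitz.isBounded_image (Metric.isBounded_ball.subset fun y hy => hy.1.2)
  have hfin : (Measure.hausdorffMeasure ((N - 1 : ℕ) : ℝ) : Measure K) (P '' S) < ⊤ := by
    have hr : Module.finrank ℝ K = N - 1 := finrank_ker_of_ne_zero hx
    rw [← hr]
    exact hbdd.measure_lt_top
  rw [Measure.euclideanHausdorffMeasure_def, Measure.smul_apply, ENNReal.smul_def, smul_eq_mul]
  refine ENNReal.mul_lt_top ENNReal.coe_lt_top ?_
  have := hg.hausdorffMeasure_image_le (Nat.cast_nonneg (N - 1) : (0:ℝ) ≤ ((N - 1 : ℕ) : ℝ))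
  rw [himg] at this
  refine this.trans_lt (ENNReal.mul_lt_top ?_ hfin)
  exact ENNReal.rpow_lt_top_of_nonneg (Nat.cast_nonneg _) ENNReal.coe_ne_top

/-- By compactness of `Γ`, since the surface measure is finite near each of its points. -/
lemma isFiniteMeasure_surface {Ω : Set (E N)} (hΩo : IsOpen Ω) (hΩb : Bornology.IsBounded Ω)
    (hΩs : HasSmoothBoundary Ω) : IsFiniteMeasure (surface Ω) := by
  constructor
  rw [surface, Measure.restrict_apply_univ]
  have hcomp : IsCompact (frontier Ω) :=
    hΩb.isCompact_closure.of_isClosed_subset isClosed_frontier frontier_subset_closure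
  refine hcomp.measure_lt_top_of_nhdsWithin fun x hx => ?_
  obtain ⟨O, ρ, hO, hxO, hρ, hdρ, hΩO⟩ := hΩs x hx
  obtain ⟨U, hU, hfin⟩ := exists_nhds_hausdorffMeasure_lt_top hρ hdρ
  refine ⟨frontier Ω ∩ (U ∩ O), inter_mem_nhdsWithin _ (inter_mem hU (hO.mem_nhds hxO)), ?_⟩
  refine (measure_mono ?_).trans_lt hfin
  rintro y ⟨hy, hyU, hyO⟩
  exact ⟨hyU, defining_function_eq_zero hΩo hO hρ.continuous hΩO hy hyO⟩

lemma isFiniteMeasure_bdry {Ω : Set (E N)} {b : E N → ℝ} (hΩo : IsOpen Ω)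
    (hΩb : Bornology.IsBounded Ω) (hΩs : HasSmoothBoundary Ω)
    (hb₀ : ∃ b₀ > 0, ∀ᵐ x ∂(surface Ω), b₀ ≤ b x) : IsFiniteMeasure (bdry Ω b) := by
  have := isFiniteMeasure_surface hΩo hΩb hΩs
  obtain ⟨b₀, hb, hle⟩ := hb₀
  apply isFiniteMeasure_withDensity
  refine ne_of_lt (lt_of_le_of_lt (lintegral_mono_ae (g := fun _ => ENNReal.ofReal (1 / b₀)) ?_) ?_)
  · filter_upwards [hle] with x hx
    exact ENNReal.ofReal_le_ofReal (one_div_le_one_div_of_le hb hx)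
  · rw [lintegral_const]
    exact ENNReal.mul_lt_top ENNReal.ofReal_lt_top (measure_lt_top _ _)

/-- The boundary measure is carried by `Γ`. -/
lemma ae_bdry_mem_frontier {Ω : Set (E N)} {b : E N → ℝ} :
    ∀ᵐ x ∂(bdry Ω b), x ∈ frontier Ω :=
  (withDensity_absolutelyContinuous _ _).ae_le (ae_restrict_mem isClosed_frontier.measurableSet)

end Surface

/-! ### Weak derivatives of smooth functions -/

section Smooth

variable {N : ℕ}

lemma contDiff_iteratedFDeriv_apply {j : ℕ} {φ : E N → ℝ} (hφ : ContDiff ℝ ∞ φ)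
    (v : Fin j → E N) : ContDiff ℝ ∞ fun x => iteratedFDeriv ℝ j φ x v :=
  (ContinuousMultilinearMap.apply ℝ (fun _ : Fin j => E N) ℝ v).contDiff.comp
    (hφ.iteratedFDeriv_right (by exact_mod_cast le_top))

/-- Iterated integration by parts. Each step moves the outermost derivative of the test function
onto the innermost place, which reverses the order of the multi-index. -/
lemma integral_mul_iteratedFDeriv (j : ℕ) (α : Fin j → Fin N) {φ ψ : E N → ℝ}
    (hφ : ContDiff ℝ ∞ φ) (hψ : ContDiff ℝ ∞ ψ) (hc : HasCompactSupport ψ) :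
    ∫ x, φ x * iteratedFDeriv ℝ j ψ x (fun l => coordVec (α l)) =
      (-1) ^ j * ∫ x, iteratedFDeriv ℝ j φ x (fun l => coordVec (α l.rev)) * ψ x := by
  induction j generalizing φ with
  | zero => simp
  | succ j ih =>
    set χ : E N → ℝ := fun x => iteratedFDeriv ℝ j ψ x (fun l => coordVec (α l.succ)) with hχ
    have χs : ContDiff ℝ ∞ χ := contDiff_iteratedFDeriv_apply hψ _
    have χc : HasCompactSupport χ := (test_deriv (fun l => α l.succ) hψ hc).2
    have e1 : ∀ x, iteratedFDeriv ℝ (j + 1) ψ x (fun l => coordVec (α l)) =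
        fderiv ℝ χ x (coordVec (α 0)) := by
      intro x
      rw [DifferentiableAt.iteratedFDeriv_succ_apply_left']
      · rfl
      · exact (hψ.differentiable_iteratedFDeriv (by exact_mod_cast ENat.natCast_lt_top j)) x
    have φ's : ContDiff ℝ ∞ fun x => fderiv ℝ φ x (coordVec (α 0)) :=
      (hφ.fderiv_right (m := ∞) (by simp)).clm_apply contDiff_const
    have χ'c : HasCompactSupport fun x => fderiv ℝ χ x (coordVec (α 0)) :=
      χc.fderiv_apply (𝕜 := ℝ) _
    have χ's : Continuous fun x => fderiv ℝ χ x (coordVec (α 0)) :=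
      ((χs.fderiv_right (m := ∞) (by simp)).clm_apply contDiff_const).continuous
    simp_rw [e1]
    rw [integral_mul_fderiv_eq_neg_fderiv_mul_of_integrable, ih _ φ's, pow_succ]
    · have e2 : ∀ x, iteratedFDeriv ℝ (j + 1) φ x (fun l => coordVec (α l.rev)) =
          iteratedFDeriv ℝ j (fun x => fderiv ℝ φ x (coordVec (α 0))) x
            (fun l => coordVec (α l.rev.succ)) := by
        intro x
        have h3 := (ContinuousLinearMap.apply ℝ ℝ (coordVec (α 0) : E N)).iteratedFDeriv_comp_left
          (f := fderiv ℝ φ) (x := x) (n := ∞) (i := j)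
          ((hφ.fderiv_right (m := ∞) (by simp)).contDiffAt) (by exact_mod_cast le_top)
        have h4 : (ContinuousLinearMap.apply ℝ ℝ (coordVec (α 0) : E N)) ∘ fderiv ℝ φ =
          fun x => fderiv ℝ φ x (coordVec (α 0)) := rfl
        rw [h4] at h3
        rw [h3, iteratedFDeriv_succ_apply_right]
        simp [Fin.init_def, Fin.rev_castSucc]
      simp_rw [e2]
      ring
    · exact (φ's.continuous.mul χs.continuous).integrable_of_hasCompactSupport χc.mul_left
    · exact (hφ.continuous.mul χ's).integrable_of_hasCompactSupport χ'c.mul_left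
    · exact (hφ.continuous.mul χs.continuous).integrable_of_hasCompactSupport χc.mul_left
    · exact fun x _ => hφ.differentiable (by simp) x
    · exact fun x _ => χs.differentiable (by simp) x

/-- The derivatives of `φ` are taken in the reversed order, as produced by
`integral_mul_iteratedFDeriv`. -/
lemma hasWeakPartial_of_contDiff {Ω : Set (E N)} {j : ℕ} (α : Fin j → Fin N) {φ : E N → ℝ}
    (hφ : ContDiff ℝ ∞ φ) :
    HasWeakPartial Ω α φ fun x => iteratedFDeriv ℝ j φ x (fun l => coordVec (α l.rev)) := by
  intro ψ hψ hc hs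
  have z0 : ∀ x ∉ Ω, ψ x = 0 := fun x hx => image_eq_zero_of_notMem_tsupport fun h => hx (hs h)
  have z1 : ∀ x ∉ Ω, iteratedFDeriv ℝ j ψ x = 0 := fun x hx =>
    image_eq_zero_of_notMem_tsupport fun h => hx (hs (tsupport_iteratedFDeriv_subset j h))
  rw [setIntegral_eq_integral_of_forall_compl_eq_zero (fun x hx => by simp [z1 x hx]),
    setIntegral_eq_integral_of_forall_compl_eq_zero (fun x hx => by simp [z0 x hx])]
  exact integral_mul_iteratedFDeriv j α hφ hψ hc

lemma isFiniteMeasure_vol {Ω : Set (E N)} (hΩb : Bornology.IsBounded Ω) :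
    IsFiniteMeasure (vol Ω) :=
  ⟨by rw [Measure.restrict_apply_univ]; exact hΩb.measure_lt_top⟩

/-- Continuous functions are bounded on compact sets. -/
lemma memLp_of_continuous {μ : Measure (E N)} [IsFiniteMeasure μ] {S : Set (E N)}
    (hS : IsCompact S) (hμ : ∀ᵐ x ∂μ, x ∈ S) {F : Type*} [NormedAddCommGroup F] {φ : E N → F}
    (hφ : Continuous φ) (r : ℝ≥0∞) : MemLp φ r μ := by
  obtain ⟨C, hC⟩ := hS.exists_bound_of_continuousOn hφ.continuousOn
  refine MemLp.of_bound hφ.aestronglyMeasurable C ?_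
  filter_upwards [hμ] with x hx using hC x hx

lemma memLp_vol_of_continuous {Ω : Set (E N)} (hΩo : IsOpen Ω) (hΩb : Bornology.IsBounded Ω)
    {F : Type*} [NormedAddCommGroup F] {φ : E N → F} (hφ : Continuous φ) (r : ℝ≥0∞) :
    MemLp φ r (vol Ω) := by
  have := isFiniteMeasure_vol hΩb
  refine memLp_of_continuous hΩb.isCompact_closure ?_ hφ r
  filter_upwards [ae_restrict_mem hΩo.measurableSet] with x hx using subset_closure hx

lemma memLp_bdry_of_continuous {Ω : Set (E N)} {b : E N → ℝ} [IsFiniteMeasure (bdry Ω b)]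
    (hΩb : Bornology.IsBounded Ω) {φ : E N → ℝ} (hφ : Continuous φ) (r : ℝ≥0∞) :
    MemLp φ r (bdry Ω b) :=
  memLp_of_continuous
    (hΩb.isCompact_closure.of_isClosed_subset isClosed_frontier frontier_subset_closure)
    ae_bdry_mem_frontier hφ r

end Smooth

/-! ### Smooth functions in the Sobolev–Slobodeckij spaces -/

section SmoothV

variable {N : ℕ}

/-- In polar coordinates. -/
lemma integrableOn_ball_norm_rpow (hN : 1 ≤ N) {κ R : ℝ} (hκ : -(N : ℝ) < κ) (hR : 0 < R) :
    IntegrableOn (fun z : E N => ‖z‖ ^ κ) (Metric.ball 0 R) volume := by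
  have : Nonempty (Fin N) := ⟨⟨0, hN⟩⟩
  have : Nontrivial (E N) := inferInstance
  rw [integrableOn_fun_norm_addHaar (volume : Measure (E N)) (f := fun r : ℝ => r ^ κ)]
  have h : IntegrableOn (fun x : ℝ => x ^ (κ + ((N:ℝ) - 1))) (Ioo 0 R) :=
    (intervalIntegral.integrableOn_Ioo_rpow_iff hR).2 (by linarith)
  refine h.congr_fun (fun x hx => ?_) measurableSet_Ioo
  simp only [finrank_euclideanSpace_fin, smul_eq_mul]
  rw [Real.rpow_add hx.1, mul_comm]
  congr 1
  rw [← Real.rpow_natCast, Nat.cast_sub hN, Nat.cast_one]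

/-- The convolution of the indicator function of `Ω` with `‖·‖ ^ κ`, cut off outside a ball. -/
lemma integrable_norm_sub_rpow {Ω : Set (E N)} (hN : 1 ≤ N) (hΩo : IsOpen Ω)
    (hΩb : Bornology.IsBounded Ω) {κ : ℝ} (hκ : -(N : ℝ) < κ) :
    Integrable (fun y : E N × E N => ‖y.1 - y.2‖ ^ κ) ((vol Ω).prod (vol Ω)) := by
  have := isFiniteMeasure_vol hΩb
  obtain ⟨R, hR⟩ := hΩb.subset_ball 0
  have hR1 : 0 < |R| + |R| + 1 := by positivity
  have h1 : Integrable ((Metric.ball (0 : E N) (|R| + |R| + 1)).indicator fun z => ‖z‖ ^ κ)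
      (volume : Measure (E N)) :=
    (integrable_indicator_iff measurableSet_ball).2 (integrableOn_ball_norm_rpow hN hκ hR1)
  have h2 := Integrable.convolution_integrand (ContinuousLinearMap.mul ℝ ℝ)
    (integrable_const (1:ℝ) : Integrable (fun _ : E N => (1:ℝ)) (vol Ω)) h1
  have h3 := h2.mono_measure (Measure.prod_mono
    (Measure.restrict_le_self : vol Ω ≤ volume) (le_refl (vol Ω)))
  refine h3.congr ?_
  have hm : ∀ᵐ y ∂((vol Ω).prod (vol Ω)), y ∈ Ω ×ˢ Ω := by
    rw [Measure.prod_restrict]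
    exact ae_restrict_mem (hΩo.measurableSet.prod hΩo.measurableSet)
  filter_upwards [hm] with y hy
  have e1 := hR hy.1
  have e2 := hR hy.2
  rw [mem_ball_zero_iff] at e1 e2
  rw [indicator_of_mem]
  · simp
  · rw [mem_ball_zero_iff]
    have := norm_sub_le y.1 y.2
    have := le_abs_self R
    linarith

/-- Lipschitz functions have finite Gagliardo seminorms on bounded sets, since
`p (1 - θ) - N > -N`. -/
lemma memLp_gagliardo {Ω : Set (E N)} (hN : 1 ≤ N) (hΩo : IsOpen Ω)
    (hΩb : Bornology.IsBounded Ω) {p θ : ℝ} (hp : 1 < p) (hθ : θ < 1) {ψ : E N → ℝ}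
    (hψ : ContDiff ℝ ∞ ψ) :
    MemLp (fun y : E N × E N => (ψ y.1 - ψ y.2) / ‖y.1 - y.2‖ ^ (N / p + θ)) (ENNReal.ofReal p)
      ((vol Ω).prod (vol Ω)) := by
  have hp0 : 0 < p := by linarith
  have := isFiniteMeasure_vol hΩb
  have hmeas : AEStronglyMeasurable
      (fun y : E N × E N => (ψ y.1 - ψ y.2) / ‖y.1 - y.2‖ ^ (N / p + θ))
      ((vol Ω).prod (vol Ω)) := by
    apply Measurable.aestronglyMeasurable
    have := hψ.continuous.measurable
    fun_prop
  obtain ⟨R, hR⟩ := hΩb.subset_ball 0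
  obtain ⟨C, hC⟩ := (isCompact_closedBall (0 : E N) R).exists_bound_of_continuousOn
    (hψ.continuous_fderiv (by simp)).continuousOn
  have hlip : ∀ x ∈ Ω, ∀ y ∈ Ω, |ψ x - ψ y| ≤ |C| * ‖x - y‖ := fun x hx y hy =>
    (convex_closedBall (0 : E N) R).norm_image_sub_le_of_norm_fderiv_le
      (fun z _ => hψ.differentiable (by simp) z)
      (fun z hz => (hC z hz).trans (le_abs_self C))
      (Metric.ball_subset_closedBall (hR hy)) (Metric.ball_subset_closedBall (hR hx))
  rw [← integrable_norm_rpow_iff hmeas (by simpa using hp0) (by simp),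
    ENNReal.toReal_ofReal hp0.le]
  have hint := (integrable_norm_sub_rpow hN hΩo hΩb (κ := p * (1 - θ) - N)
    (by nlinarith)).const_mul (|C| ^ p)
  refine hint.mono' ((hmeas.norm.aemeasurable.pow_const p).aestronglyMeasurable) ?_
  have hm : ∀ᵐ y ∂((vol Ω).prod (vol Ω)), y ∈ Ω ×ˢ Ω := by
    rw [Measure.prod_restrict]
    exact ae_restrict_mem (hΩo.measurableSet.prod hΩo.measurableSet)
  filter_upwards [hm] with y hy
  rw [Real.norm_of_nonneg (by positivity), norm_div, Real.norm_eq_abs, Real.norm_eq_abs,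
    abs_of_nonneg (by positivity : 0 ≤ ‖y.1 - y.2‖ ^ (N / p + θ))]
  rcases eq_or_ne y.1 y.2 with h | h
  · rw [h, sub_self, abs_zero, zero_div, Real.zero_rpow hp0.ne']
    positivity
  · have hd : 0 < ‖y.1 - y.2‖ := norm_pos_iff.2 (sub_ne_zero.2 h)
    have h1 : |ψ y.1 - ψ y.2| / ‖y.1 - y.2‖ ^ (N / p + θ) ≤
        |C| * ‖y.1 - y.2‖ ^ (1 - (N / p + θ)) := by
      rw [div_le_iff₀ (by positivity), mul_assoc, ← Real.rpow_add hd, sub_add_cancel,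
        Real.rpow_one]
      exact hlip _ hy.1 _ hy.2
    refine (Real.rpow_le_rpow (by positivity) h1 hp0.le).trans (le_of_eq ?_)
    rw [Real.mul_rpow (abs_nonneg _) (by positivity), ← Real.rpow_mul hd.le]
    congr 2
    field_simp
    ring

/-- The gradient as a vector of partial derivatives, in the form recorded by jets. -/
def gradVec (φ : E N → ℝ) (x : E N) : E N := WithLp.toLp 2 fun i => fderiv ℝ φ x (coordVec i)

lemma continuous_gradVec {φ : E N → ℝ} (hφ : ContDiff ℝ ∞ φ) : Continuous (gradVec φ) := by
  have h := hφ.continuous_fderiv (by simp)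
  unfold gradVec
  fun_prop

/-- Smooth functions on `ℝ^N` belong to all Sobolev-Slobodeckij spaces of a bounded open set. -/
lemma exists_isSobolevJet {Ω : Set (E N)} (hN : 1 ≤ N) (hΩo : IsOpen Ω)
    (hΩb : Bornology.IsBounded Ω) {p θ : ℝ} [hp : Fact (1 < p)] (hθ : θ < 1) (m : ℕ)
    {φ : E N → ℝ} (hφ : ContDiff ℝ ∞ φ) :
    ∃ z : Jet Ω m p, IsSobolevJet θ z ∧ z.fn =ᵐ[vol Ω] φ ∧
      (1 ≤ m → ∀ i, z.part i =ᵐ[vol Ω] fun x => fderiv ℝ φ x (coordVec i)) := by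
  let D : (j : ℕ) → (Fin j → Fin N) → E N → ℝ := fun j α x =>
    iteratedFDeriv ℝ j φ x (fun l => coordVec (α l.rev))
  have Ds : ∀ j α, ContDiff ℝ ∞ (D j α) := fun j α => contDiff_iteratedFDeriv_apply hφ _
  have Dm : ∀ j α, MemLp (D j α) (ENNReal.ofReal p) (vol Ω) := fun j α =>
    memLp_vol_of_continuous hΩo hΩb (Ds j α).continuous _
  -- for `θ = 0` the jet records no difference quotients, and its second component has to vanish
  let z : Jet Ω m p := ⟨fun j α => (Dm j α).toLp, fun α => if θ = 0 then 0 else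
    (memLp_gagliardo hN hΩo hΩb hp.out hθ (Ds m α)).toLp⟩
  have hz : ∀ (j : Fin (m + 1)) (α : Fin j → Fin N), z.1 j α =ᵐ[vol Ω] D j α := fun j α =>
    (Dm j α).coeFn_toLp
  have hfn : z.fn =ᵐ[vol Ω] φ := by
    refine (hz ⟨0, m.succ_pos⟩ Fin.elim0).trans (.of_forall fun x => ?_)
    simp [D]
  refine ⟨z, ⟨fun j α ψ hψ hc hs => ?_, fun α => ⟨fun h => ?_, fun h => ?_⟩⟩, hfn,
    fun hm i => ?_⟩
  · have h1 := hasWeakPartial_of_contDiff (Ω := Ω) α hφ ψ hψ hc hs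
    have e1 : ∫ x in Ω, z.fn x * iteratedFDeriv ℝ j ψ x (fun l => coordVec (α l)) =
        ∫ x in Ω, φ x * iteratedFDeriv ℝ j ψ x (fun l => coordVec (α l)) := by
      apply integral_congr_ae
      filter_upwards [hfn] with x hx
      rw [hx]
    have e2 : ∫ x in Ω, z.1 j α x * ψ x = ∫ x in Ω, D j α x * ψ x := by
      apply integral_congr_ae
      filter_upwards [hz j α] with x hx
      rw [hx]
    rw [e1, e2, h1]
  · simp [z, h]
  · have e0 : z.2 α = (memLp_gagliardo hN hΩo hΩb hp.out hθ (Ds m α)).toLp := by simp [z, h]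
    rw [e0]
    have := isFiniteMeasure_vol hΩb
    filter_upwards [(memLp_gagliardo hN hΩo hΩb hp.out hθ (Ds m α)).coeFn_toLp,
      Measure.quasiMeasurePreserving_fst.ae_eq_comp (hz (Fin.last m) α),
      Measure.quasiMeasurePreserving_snd.ae_eq_comp (hz (Fin.last m) α)] with y h1 h2 h3
    simp only [Function.comp_apply] at h2 h3
    rw [h1, h2, h3]
    rfl
  · unfold Jet.part
    rw [dif_pos hm]
    refine (hz ⟨1, Nat.lt_succ_of_le hm⟩ (fun _ => i)).trans (.of_forall fun x => ?_)
    simp [D]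

/-- Smooth functions on `ℝ^N`, with their boundary values, belong to `V^{k,p}`. -/
lemma exists_mem_V {Ω : Set (E N)} {b : E N → ℝ} [IsFiniteMeasure (bdry Ω b)] (hN : 1 ≤ N)
    (hΩo : IsOpen Ω) (hΩb : Bornology.IsBounded Ω) {p k : ℝ} [hp : Fact (1 < p)] (hk : 1 ≤ k)
    {φ : E N → ℝ} (hφ : ContDiff ℝ ∞ φ) :
    ∃ Ξ : V Ω b k p, Ξ.1.1.fst =ᵐ[vol Ω] φ ∧ Ξ.1.1.snd =ᵐ[bdry Ω b] φ ∧
      Jet.grad (Ξ.1.2 : Jet Ω ⌊k⌋₊ p) =ᵐ[vol Ω] gradVec φ := by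
  have hm : 1 ≤ ⌊k⌋₊ := by
    rw [Nat.one_le_floor_iff]
    exact hk
  obtain ⟨z, hz, hfn, hpart⟩ :=
    exists_isSobolevJet (p := p) hN hΩo hΩb (Int.fract_lt_one k) ⌊k⌋₊ hφ
  let U : X2 Ω b := WithLp.toLp 2 ((memLp_vol_of_continuous hΩo hΩb hφ.continuous 2).toLp,
    (memLp_bdry_of_continuous (b := b) hΩb hφ.continuous 2).toLp)
  have h1 : U.fst =ᵐ[vol Ω] φ := (memLp_vol_of_continuous hΩo hΩb hφ.continuous 2).coeFn_toLp
  have h2 : U.snd =ᵐ[bdry Ω b] φ :=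
    (memLp_bdry_of_continuous (b := b) hΩb hφ.continuous 2).coeFn_toLp
  have zero : ∀ (μ : Measure (E N)) (w w' : E N → ℝ), w' =ᵐ[μ] w →
      Tendsto (fun _ : ℕ => eLpNorm (fun x => w x - w' x) (ENNReal.ofReal p) μ) atTop (𝓝 0) := by
    intro μ w w' h
    rw [eLpNorm_congr_ae (g := 0), eLpNorm_zero]
    · exact tendsto_const_nhds
    · filter_upwards [h] with x hx
      simp [hx]
  refine ⟨⟨(U, ⟨z, hz⟩), h1.trans hfn.symm, fun _ => φ, fun _ => hφ, zero _ _ _ hfn,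
    fun i => zero _ _ _ (hpart hm i), zero _ _ _ h2⟩, h1, h2, ?_⟩
  filter_upwards [ae_all_iff.2 (hpart hm)] with x hx
  simp only [Jet.grad, gradVec, hx]

end SmoothV

/-! ### The flux as a Nemytskii operator -/

section Nemytskii

/-- Dominated convergence in `L^q`. -/
lemma tendsto_eLpNorm_of_dominated {α F F' : Type*} [MeasurableSpace α] {μ : Measure α}
    [NormedAddCommGroup F] [NormedAddCommGroup F'] {q : ℝ≥0∞} (hq0 : q ≠ 0) (hq : q ≠ ⊤)
    {f : ℕ → α → F} {g : α → F'} (hf : ∀ n, AEStronglyMeasurable (f n) μ) (hg : MemLp g q μ)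
    (hle : ∀ n x, ‖f n x‖ ≤ ‖g x‖) (hlim : ∀ x, Tendsto (fun n => f n x) atTop (𝓝 0)) :
    Tendsto (fun n => eLpNorm (f n) q μ) atTop (𝓝 0) := by
  have hr : 0 < q.toReal := ENNReal.toReal_pos hq0 hq
  simp only [eLpNorm_eq_lintegral_rpow_enorm_toReal hq0 hq]
  have h1 : Tendsto (fun n => ∫⁻ x, ‖f n x‖ₑ ^ q.toReal ∂μ) atTop (𝓝 (∫⁻ _, 0 ∂μ)) := by
    apply tendsto_lintegral_of_dominated_convergence' (fun x => ‖g x‖ₑ ^ q.toReal)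
    · exact fun n => (hf n).enorm.pow_const _
    · exact fun n => .of_forall fun x =>
        ENNReal.rpow_le_rpow (enorm_le_iff_norm_le.2 (hle n x)) hr.le
    · exact (lintegral_rpow_enorm_lt_top_of_eLpNorm_lt_top hq0 hq hg.2).ne
    · refine .of_forall fun x => ?_
      have := ((ENNReal.continuous_rpow_const (y := q.toReal)).tendsto 0).comp
        (((hlim x).enorm).trans (by simp))
      simpa [Function.comp_def, ENNReal.zero_rpow_of_pos hr] using this
  rw [lintegral_zero] at h1
  have := ((ENNReal.continuous_rpow_const (y := 1 / q.toReal)).tendsto 0).comp h1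
  simpa [Function.comp_def, hr] using this

variable {N : ℕ} {p : ℝ} {a : ℝ → ℝ}

/-- The flux `y ↦ a(|y|²) y`. -/
def flux (a : ℝ → ℝ) (y : E N) : E N := a (‖y‖ ^ 2) • y

lemma FluxAssumptions.exists_norm_flux_le (ha : FluxAssumptions N p a) (hp : 2 ≤ p) :
    ∃ c : ℝ, 0 < c ∧ ∀ y : E N, ‖flux a y‖ ≤ c * (1 + 2 * ‖y‖ ^ (p - 1)) := by
  obtain ⟨c, hc, h⟩ := ha.growth
  refine ⟨c, hc, fun y => ?_⟩
  rw [flux, norm_smul, Real.norm_eq_abs]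
  refine (mul_le_mul_of_nonneg_right (h y) (norm_nonneg _)).trans ?_
  rw [mul_assoc]
  refine mul_le_mul_of_nonneg_left ?_ hc.le
  have h1 : ‖y‖ ^ (p - 2) * ‖y‖ = ‖y‖ ^ (p - 1) := by
    rcases (norm_nonneg y).eq_or_lt with h0 | h0
    · rw [← h0, mul_zero, Real.zero_rpow (by linarith)]
    · nth_rewrite 2 [← Real.rpow_one ‖y‖]
      rw [← Real.rpow_add h0]
      congr 1
      ring
  have h2 : ‖y‖ ≤ 1 + ‖y‖ ^ (p - 1) := by
    rcases le_total ‖y‖ 1 with h0 | h0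
    · have : 0 ≤ ‖y‖ ^ (p - 1) := by positivity
      linarith
    · have := Real.rpow_le_rpow_of_exponent_le h0 (by linarith : 1 ≤ p - 1)
      rw [Real.rpow_one] at this
      linarith
  rw [add_mul, one_mul, h1]
  linarith

lemma FluxAssumptions.continuous_flux (ha : FluxAssumptions N p a) :
    Continuous (flux a : E N → E N) := ha.contDiff.continuous

instance factOneLeConj [h : Fact (1 < p)] : Fact (1 ≤ ENNReal.ofReal (p / (p - 1))) :=
  ⟨by
    have := h.out
    rw [ENNReal.one_le_ofReal, le_div_iff₀ (by linarith)]
    linarith⟩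

instance holderConjugate_conj [h : Fact (1 < p)] :
    (ENNReal.ofReal (p / (p - 1))).HolderConjugate (ENNReal.ofReal p) :=
  (Real.HolderConjugate.conjExponent h.out).symm.ennrealOfReal

variable {μ : Measure (E N)} [IsFiniteMeasure μ]

/-- The growth condition turns `L^p`-bounds into `L^q`-bounds for the flux. -/
lemma exists_eLpNorm_flux_le [h1p : Fact (1 < p)] (ha : FluxAssumptions N p a) (hp : 2 ≤ p) :
    ∃ C : ℝ≥0∞, C ≠ ⊤ ∧ ∀ u : E N → E N, AEStronglyMeasurable u μ →
      eLpNorm (fun x => flux a (u x)) (ENNReal.ofReal (p / (p - 1))) μ ≤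
        C * (1 + eLpNorm u (ENNReal.ofReal p) μ ^ (p - 1)) := by
  obtain ⟨c, hc, hle⟩ := ha.exists_norm_flux_le hp
  have hp1 : 0 < p - 1 := by linarith
  set q := ENNReal.ofReal (p / (p - 1)) with hq
  have hq1 : 1 ≤ q := Fact.out
  set K := eLpNorm (fun _ : E N => c) q μ with hK
  have hKt : K ≠ ⊤ := (memLp_const c).2.ne
  refine ⟨K + ENNReal.ofReal (2 * c), by finiteness, fun u hu => ?_⟩
  have hpow : eLpNorm (fun x => ‖u x‖ ^ (p - 1)) q μ = eLpNorm u (ENNReal.ofReal p) μ ^ (p - 1) := by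
    rw [eLpNorm_norm_rpow u hp1, hq, ← ENNReal.ofReal_mul (by positivity),
      div_mul_cancel₀ _ hp1.ne']
  have hm : AEStronglyMeasurable (fun x => ‖u x‖ ^ (p - 1)) μ :=
    (hu.norm.aemeasurable.pow_const _).aestronglyMeasurable
  calc eLpNorm (fun x => flux a (u x)) q μ
      ≤ eLpNorm ((fun _ => c) + (2 * c) • fun x => ‖u x‖ ^ (p - 1)) q μ := by
        apply eLpNorm_mono_real
        intro x
        refine (hle (u x)).trans (le_of_eq ?_)
        simp only [Pi.add_apply, Pi.smul_apply, smul_eq_mul]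
        ring
    _ ≤ K + ENNReal.ofReal (2 * c) * eLpNorm u (ENNReal.ofReal p) μ ^ (p - 1) := by
        refine (eLpNorm_add_le aestronglyMeasurable_const (hm.const_smul _) hq1).trans ?_
        rw [eLpNorm_const_smul, hpow, Real.enorm_eq_ofReal (by positivity)]
    _ ≤ (K + ENNReal.ofReal (2 * c)) * (1 + eLpNorm u (ENNReal.ofReal p) μ ^ (p - 1)) := by
        rw [mul_add, mul_one]
        gcongr
        · exact le_self_add
        · exact le_add_self

lemma memLp_flux [Fact (1 < p)] (ha : FluxAssumptions N p a) (hp : 2 ≤ p) {u : E N → E N}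
    (hu : MemLp u (ENNReal.ofReal p) μ) :
    MemLp (fun x => flux a (u x)) (ENNReal.ofReal (p / (p - 1))) μ := by
  obtain ⟨C, hC, h⟩ := exists_eLpNorm_flux_le (μ := μ) ha hp
  refine ⟨ha.continuous_flux.comp_aestronglyMeasurable hu.1, (h u hu.1).trans_lt ?_⟩
  have := ENNReal.rpow_lt_top_of_nonneg (by linarith : 0 ≤ p - 1) hu.2.ne
  exact ENNReal.mul_lt_top hC.lt_top (ENNReal.add_lt_top.2 ⟨ENNReal.one_lt_top, this⟩)

/-- The flux as a Nemytskii operator `L^p → L^q`, `q = p / (p - 1)`. -/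
def nemFlux [Fact (1 < p)] (ha : FluxAssumptions N p a) (hp : 2 ≤ p)
    (u : Lp (E N) (ENNReal.ofReal p) μ) : Lp (E N) (ENNReal.ofReal (p / (p - 1))) μ :=
  (memLp_flux ha hp (Lp.memLp u)).toLp

lemma coeFn_nemFlux [Fact (1 < p)] (ha : FluxAssumptions N p a) (hp : 2 ≤ p)
    (u : Lp (E N) (ENNReal.ofReal p) μ) : nemFlux ha hp u =ᵐ[μ] fun x => flux a (u x) :=
  MemLp.coeFn_toLp _

/-- Composition with a Lipschitz function is continuous from `L^p` to `L^q` for `q ≤ p`. -/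
lemma continuous_comp_of_lipschitz {p q : ℝ≥0∞} [Fact (1 ≤ p)] [Fact (1 ≤ q)] (hqp : q ≤ p)
    (hp : p ≠ ⊤) {B : E N → E N} {K : NNReal} (hB : LipschitzWith K B)
    (hm : ∀ u : Lp (E N) p μ, MemLp (fun x => B (u x)) q μ) :
    Continuous fun u : Lp (E N) p μ => (hm u).toLp := by
  set M : ℝ≥0∞ := μ univ ^ (1 / q.toReal - 1 / p.toReal) with hM
  have hMt : M ≠ ⊤ := by
    apply ENNReal.rpow_ne_top_of_nonneg _ (measure_ne_top _ _)
    have hq0 : 0 < q.toReal := ENNReal.toReal_pos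
      (zero_lt_one.trans_le (Fact.out : 1 ≤ q)).ne' (ne_top_of_le_ne_top hp hqp)
    exact sub_nonneg.2 (one_div_le_one_div_of_le hq0 (ENNReal.toReal_mono hp hqp))
  have : LipschitzWith (K * M.toNNReal) fun u : Lp (E N) p μ => (hm u).toLp := by
    intro u v
    rw [Lp.edist_toLp_toLp, Lp.edist_def]
    calc eLpNorm ((fun x => B (u x)) - fun x => B (v x)) q μ
        ≤ eLpNorm ((fun x => B (u x)) - fun x => B (v x)) p μ * M :=
          eLpNorm_le_eLpNorm_mul_rpow_measure_univ hqp ((hm u).1.sub (hm v).1)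
      _ ≤ (K • eLpNorm (⇑u - ⇑v) p μ) * M := by
          gcongr
          apply eLpNorm_le_nnreal_smul_eLpNorm_of_ae_le_mul
          refine .of_forall fun x => ?_
          exact_mod_cast hB.norm_sub_le (u x) (v x)
      _ = _ := by
          rw [ENNReal.coe_mul, ENNReal.coe_toNNReal hMt, ENNReal.smul_def, smul_eq_mul]
          ring
  exact this.continuous

/-- Measurability of `t ↦ a(|w(t)|²) w(t)`: truncating the flux makes it compactly supported, hence
Lipschitz, so that the truncated superposition operators are continuous; they converge pointwise. -/
lemma aestronglyMeasurable_nemFlux [Fact (1 < p)] (ha : FluxAssumptions N p a) (hp : 2 ≤ p)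
    {α : Type*} [MeasurableSpace α] {ν : Measure α} {w : α → Lp (E N) (ENNReal.ofReal p) μ}
    (hw : AEStronglyMeasurable w ν) : AEStronglyMeasurable (fun t => nemFlux ha hp (w t)) ν := by
  let χ : (n : ℕ) → ContDiffBump (0 : E N) := fun n => ⟨n + 1, n + 2, by positivity, by linarith⟩
  have hqp : ENNReal.ofReal (p / (p - 1)) ≤ ENNReal.ofReal p := by
    apply ENNReal.ofReal_le_ofReal
    rw [div_le_iff₀ (by linarith)]
    nlinarith
  have hs : ∀ n, ContDiff ℝ 1 fun y : E N => χ n y • flux a y := fun n =>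
    (χ n).contDiff.smul ha.contDiff
  have hc : ∀ n, HasCompactSupport fun y : E N => χ n y • flux a y := fun n =>
    (χ n).hasCompactSupport.smul_right
  have hle : ∀ n y, ‖χ n y • flux a y‖ ≤ ‖flux a y‖ := by
    intro n y
    rw [norm_smul, Real.norm_of_nonneg (χ n).nonneg]
    exact mul_le_of_le_one_left (norm_nonneg _) (χ n).le_one
  have hm : ∀ n (u : Lp (E N) (ENNReal.ofReal p) μ), MemLp (fun x => χ n (u x) • flux a (u x))
      (ENNReal.ofReal (p / (p - 1))) μ := fun n u =>
    (memLp_flux ha hp (Lp.memLp u)).mono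
      ((hs n).continuous.comp_aestronglyMeasurable (Lp.aestronglyMeasurable u))
      (.of_forall fun x => hle n _)
  refine aestronglyMeasurable_of_tendsto_ae atTop (f := fun n t => (hm n (w t)).toLp)
    (fun n => ?_) (.of_forall fun t => ?_)
  · obtain ⟨K, hK⟩ := (hs n).lipschitzWith_of_hasCompactSupport (hc n) (by simp)
    exact (continuous_comp_of_lipschitz hqp ENNReal.ofReal_ne_top hK (hm n)).comp_aestronglyMeasurable hw
  · rw [nemFlux, Lp.tendsto_Lp_iff_tendsto_eLpNorm'']
    refine tendsto_eLpNorm_of_dominated (g := fun x => flux a (w t x)) ?_ (by simp) (fun n => ?_)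
      (memLp_flux ha hp (Lp.memLp (w t))) (fun n x => ?_) (fun x => ?_)
    · exact (zero_lt_one.trans_le (Fact.out (p := 1 ≤ ENNReal.ofReal (p / (p - 1))))).ne'
    · exact (hm n (w t)).1.sub (memLp_flux ha hp (Lp.memLp (w t))).1
    · simp only [Pi.sub_apply]
      have : χ n (w t x) • flux a (w t x) - flux a (w t x) =
          -((1 - χ n (w t x)) • flux a (w t x)) := by
        rw [sub_smul, one_smul, neg_sub]
      rw [this, norm_neg, norm_smul, Real.norm_of_nonneg (by linarith [(χ n).le_one (x := w t x)])]
      exact mul_le_of_le_one_left (norm_nonneg _) (by linarith [(χ n).nonneg (x := w t x)])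
    · refine tendsto_const_nhds.congr' ?_
      obtain ⟨m, hmx⟩ := exists_nat_gt ‖w t x‖
      filter_upwards [eventually_ge_atTop m] with n hn
      have hmn : (m : ℝ) ≤ n := by exact_mod_cast hn
      have : χ n (w t x) = 1 := by
        apply (χ n).one_of_mem_closedBall
        rw [mem_closedBall_zero_iff]
        change ‖w t x‖ ≤ (n : ℝ) + 1
        linarith
      simp [this]

lemma memLp_nemFlux [h1p : Fact (1 < p)] (ha : FluxAssumptions N p a) (hp : 2 ≤ p)
    {α : Type*} [MeasurableSpace α] {ν : Measure α} [IsFiniteMeasure ν]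
    {w : α → Lp (E N) (ENNReal.ofReal p) μ} (hw : MemLp w (ENNReal.ofReal p) ν) :
    MemLp (fun t => nemFlux ha hp (w t)) (ENNReal.ofReal (p / (p - 1))) ν := by
  obtain ⟨C, hC, h⟩ := exists_eLpNorm_flux_le (μ := μ) ha hp
  have hp1 : 0 < p - 1 := by linarith
  have hpow : MemLp (fun t => ‖w t‖ ^ (p - 1)) (ENNReal.ofReal (p / (p - 1))) ν := by
    have := hw.norm_rpow_div (ENNReal.ofReal (p - 1))
    rwa [ENNReal.toReal_ofReal hp1.le, ← ENNReal.ofReal_div_of_pos hp1] at this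
  have hbd : MemLp (fun t => C.toReal * (1 + ‖w t‖ ^ (p - 1)))
      (ENNReal.ofReal (p / (p - 1))) ν := ((memLp_const (1:ℝ)).add hpow).const_mul C.toReal
  refine hbd.mono' (aestronglyMeasurable_nemFlux ha hp hw.1) (.of_forall fun t => ?_)
  rw [nemFlux, Lp.norm_toLp, Lp.norm_def]
  have h1 := h (w t) (Lp.aestronglyMeasurable _)
  have h2 : eLpNorm (w t) (ENNReal.ofReal p) μ ≠ ⊤ := Lp.eLpNorm_ne_top _
  have h3 := ENNReal.toReal_mono (by
    refine ENNReal.mul_ne_top hC (ENNReal.add_ne_top.2 ⟨ENNReal.one_ne_top, ?_⟩)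
    exact ENNReal.rpow_ne_top_of_nonneg hp1.le h2) h1
  refine h3.trans (le_of_eq ?_)
  rw [ENNReal.toReal_mul, ENNReal.toReal_add ENNReal.one_ne_top
    (ENNReal.rpow_ne_top_of_nonneg hp1.le h2), ENNReal.toReal_one, ENNReal.toReal_rpow]

end Nemytskii

/-! ### Reaction terms and the gradient operator -/

section Spaces

variable {N : ℕ} {Ω : Set (E N)} {b : E N → ℝ} {p : ℝ}

/-- The real inner product as a bounded bilinear map. -/
def innerBilin (F : Type*) [NormedAddCommGroup F] [InnerProductSpace ℝ F] : F →L[ℝ] F →L[ℝ] ℝ :=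
  innerSL ℝ

@[simp] lemma innerBilin_apply {F : Type*} [NormedAddCommGroup F] [InnerProductSpace ℝ F]
    (x y : F) : innerBilin F x y = inner ℝ x y := rfl

/-- A `C¹` function agrees, up to an additive constant, with a globally Lipschitz function on each
bounded interval. -/
lemma exists_lipschitz_cutoff {f : ℝ → ℝ} (hf : ContDiff ℝ 1 f) {C : ℝ} (hC : 0 ≤ C) :
    ∃ (K : NNReal) (F : ℝ → ℝ), LipschitzWith K F ∧ F 0 = 0 ∧
      ∀ x y, |x| ≤ C → |y| ≤ C → F x - F y = f x - f y := by
  have hCC : -C ≤ C := by linarith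
  obtain ⟨K, hK⟩ := hf.contDiffOn.exists_lipschitzOnWith (s := Icc (-C) C) (by simp)
    (convex_Icc _ _) isCompact_Icc
  have hl : LipschitzWith K fun x : ℝ => f (projIcc (-C) C hCC x) := by
    have h1 : LipschitzWith K fun x : Icc (-C) C => f x := fun x y => hK x.2 y.2
    have := h1.comp (LipschitzWith.projIcc hCC)
    rwa [mul_one] at this
  refine ⟨K, fun x => f (projIcc (-C) C hCC x) - f 0, ?_, ?_, fun x y hx hy => ?_⟩
  · have := hl.sub (LipschitzWith.const (f 0))
    rwa [add_zero] at this
  · have : (0:ℝ) ∈ Icc (-C) C := ⟨by linarith, hC⟩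
    simp [projIcc_of_mem hCC this]
  · beta_reduce
    rw [projIcc_of_mem hCC (abs_le.1 hx), projIcc_of_mem hCC (abs_le.1 hy)]
    simp

/-- The map `(u, v) ↦ (F ∘ u, G ∘ v)` on `X²`, for Lipschitz functions `F` and `G` vanishing
at `0`. -/
def reaction {K : NNReal} {F G : ℝ → ℝ} (hF : LipschitzWith K F) (hF0 : F 0 = 0)
    (hG : LipschitzWith K G) (hG0 : G 0 = 0) (U : X2 Ω b) : X2 Ω b :=
  WithLp.toLp 2 (hF.compLp hF0 U.fst, hG.compLp hG0 U.snd)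

lemma lipschitzWith_reaction {K : NNReal} {F G : ℝ → ℝ} (hF : LipschitzWith K F) (hF0 : F 0 = 0)
    (hG : LipschitzWith K G) (hG0 : G 0 = 0) :
    LipschitzWith K (reaction hF hF0 hG hG0 : X2 Ω b → X2 Ω b) := by
  apply LipschitzWith.of_dist_le_mul
  intro U V
  rw [dist_eq_norm, dist_eq_norm]
  refine abs_le_of_sq_le_sq' ?_ (by positivity) |>.2
  rw [mul_pow, WithLp.prod_norm_sq_eq_of_L2, WithLp.prod_norm_sq_eq_of_L2, mul_add,
    ← mul_pow, ← mul_pow]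
  have h1 := hF.norm_compLp_sub_le hF0 U.fst V.fst
  have h2 := hG.norm_compLp_sub_le hG0 U.snd V.snd
  exact add_le_add (pow_le_pow_left₀ (norm_nonneg _) h1 2)
    (pow_le_pow_left₀ (norm_nonneg _) h2 2)

lemma reaction_zero {K : NNReal} {F G : ℝ → ℝ} (hF : LipschitzWith K F) (hF0 : F 0 = 0)
    (hG : LipschitzWith K G) (hG0 : G 0 = 0) :
    reaction hF hF0 hG hG0 (0 : X2 Ω b) = 0 := by
  have h : ∀ {μ : Measure (E N)} {L : NNReal} {H : ℝ → ℝ} (hH : LipschitzWith L H)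
      (hH0 : H 0 = 0), hH.compLp hH0 (0 : Lp ℝ 2 μ) = 0 := by
    intro μ L H hH hH0
    have := hH.norm_compLp_le hH0 (0 : Lp ℝ 2 μ)
    rw [norm_zero, mul_zero] at this
    exact norm_le_zero_iff.1 this
  unfold reaction
  rw [WithLp.zero_fst, WithLp.zero_snd, h, h]
  rfl

lemma coeFn_finset_sum {α ι F : Type*} [MeasurableSpace α] {μ : Measure α} [NormedAddCommGroup F]
    {q : ℝ≥0∞} (s : Finset ι) (f : ι → Lp F q μ) :
    (∑ i ∈ s, f i : Lp F q μ) =ᵐ[μ] fun x => ∑ i ∈ s, f i x := by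
  classical
  induction s using Finset.induction_on with
  | empty =>
    filter_upwards [Lp.coeFn_zero F q μ] with x hx
    simpa using hx
  | insert i s hi ih =>
    rw [Finset.sum_insert hi]
    filter_upwards [Lp.coeFn_add (f i) (∑ i ∈ s, f i), ih] with x h1 h2
    rw [h1, Pi.add_apply, h2, Finset.sum_insert hi]

/-- The gradient `W^{1,p}(Ω) → L^p(Ω; ℝ^N)`. -/
def gradL (Ω : Set (E N)) (p : ℝ) [Fact (1 < p)] :
    Sobolev Ω 1 0 p →L[ℝ] Lp (E N) (ENNReal.ofReal p) (vol Ω) :=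
  ∑ i : Fin N, ((ContinuousLinearMap.toSpanSingleton ℝ (coordVec i : E N)).compLpL
    (ENNReal.ofReal p) (vol Ω)).comp
      ((ContinuousLinearMap.proj (R := ℝ)
          (φ := fun _ : Fin 1 → Fin N => Lp ℝ (ENNReal.ofReal p) (vol Ω)) (fun _ => i)).comp
        ((ContinuousLinearMap.proj (R := ℝ) (φ := fun j : Fin 2 =>
          (Fin (j : ℕ) → Fin N) → Lp ℝ (ENNReal.ofReal p) (vol Ω)) 1).comp
        ((ContinuousLinearMap.fst ℝ _ _).comp (Sobolev Ω 1 0 p).subtypeL)))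

lemma coeFn_gradL [Fact (1 < p)] (w : Sobolev Ω 1 0 p) :
    gradL Ω p w =ᵐ[vol Ω] Jet.grad (w : Jet Ω 1 p) := by
  have h : ∀ i : Fin N, ∀ᵐ x ∂(vol Ω),
      ((ContinuousLinearMap.toSpanSingleton ℝ (coordVec i : E N)).compLpL
        (ENNReal.ofReal p) (vol Ω) ((w : Jet Ω 1 p).1 1 fun _ => i)) x =
      (w : Jet Ω 1 p).part i x • coordVec i := by
    intro i
    filter_upwards [ContinuousLinearMap.coeFn_compLpL (p := ENNReal.ofReal p) (μ := vol Ω)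
      (ContinuousLinearMap.toSpanSingleton ℝ (coordVec i : E N))
      ((w : Jet Ω 1 p).1 1 fun _ => i)] with x hx
    rw [hx]
    rfl
  have e : gradL Ω p w = ∑ i : Fin N,
      (ContinuousLinearMap.toSpanSingleton ℝ (coordVec i : E N)).compLpL
        (ENNReal.ofReal p) (vol Ω) ((w : Jet Ω 1 p).1 1 fun _ => i) := by
    simp only [gradL, sum_apply]
    rfl
  rw [e]
  filter_upwards [ae_all_iff.2 h, coeFn_finset_sum (Finset.univ : Finset (Fin N)) fun i =>
    (ContinuousLinearMap.toSpanSingleton ℝ (coordVec i : E N)).compLpL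
        (ENNReal.ofReal p) (vol Ω) ((w : Jet Ω 1 p).1 1 fun _ => i)] with x hx hs
  rw [hs]
  simp only [hx]
  ext j
  simp [Jet.grad, coordVec, Pi.single_apply]

end Spaces

/-! ### Smooth approximation and the tested equation -/

section Equation

variable {N : ℕ} {Ω : Set (E N)} {b : E N → ℝ} {p : ℝ}

/-- The pair of a smooth function with its boundary values, and its gradient. -/
def smoothPair (b : E N → ℝ) [IsFiniteMeasure (bdry Ω b)] (hΩo : IsOpen Ω)
    (hΩb : Bornology.IsBounded Ω) (p : ℝ) {φ : E N → ℝ} (hφ : ContDiff ℝ ∞ φ) :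
    X2 Ω b × Lp (E N) (ENNReal.ofReal p) (vol Ω) :=
  (WithLp.toLp 2 ((memLp_vol_of_continuous hΩo hΩb hφ.continuous 2).toLp,
    (memLp_bdry_of_continuous (b := b) hΩb hφ.continuous 2).toLp),
    (memLp_vol_of_continuous hΩo hΩb (continuous_gradVec hφ) _).toLp)

/-- The element of `V^{k,p}` given by a smooth function, in terms of `smoothPair`. -/
lemma exists_mem_V_smoothPair [IsFiniteMeasure (bdry Ω b)] (hN : 1 ≤ N) (hΩo : IsOpen Ω)
    (hΩb : Bornology.IsBounded Ω) {k : ℝ} [Fact (1 < p)] (hk : 1 ≤ k) {φ : E N → ℝ}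
    (hφ : ContDiff ℝ ∞ φ) :
    ∃ Ξ : V Ω b k p, Ξ.1.1 = (smoothPair b hΩo hΩb p hφ).1 ∧
      (smoothPair b hΩo hΩb p hφ).2 =ᵐ[vol Ω] Jet.grad (Ξ.1.2 : Jet Ω ⌊k⌋₊ p) := by
  obtain ⟨Ξ, e1, e2, e3⟩ := exists_mem_V (b := b) (p := p) hN hΩo hΩb hk hφ
  refine ⟨Ξ, ?_, (memLp_vol_of_continuous hΩo hΩb (continuous_gradVec hφ) _).coeFn_toLp.trans
    e3.symm⟩
  apply WithLp.ofLp_injective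
  apply Prod.ext
  · exact Lp.ext (e1.trans (memLp_vol_of_continuous hΩo hΩb hφ.continuous 2).coeFn_toLp.symm)
  · exact Lp.ext (e2.trans
      (memLp_bdry_of_continuous (b := b) hΩb hφ.continuous 2).coeFn_toLp.symm)

lemma tendsto_eLpNorm_of_exponent_le {α F : Type*} [MeasurableSpace α] [NormedAddCommGroup F]
    {μ : Measure α} [IsFiniteMeasure μ] {p q : ℝ≥0∞} (hq0 : q ≠ 0) (hqp : q ≤ p) (hp : p ≠ ⊤)
    {f : ℕ → α → F} (hf : ∀ n, AEStronglyMeasurable (f n) μ)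
    (h : Tendsto (fun n => eLpNorm (f n) p μ) atTop (𝓝 0)) :
    Tendsto (fun n => eLpNorm (f n) q μ) atTop (𝓝 0) := by
  have hq : 0 < q.toReal := ENNReal.toReal_pos hq0 (ne_top_of_le_ne_top hp hqp)
  have hM : μ univ ^ (1 / q.toReal - 1 / p.toReal) ≠ ⊤ :=
    ENNReal.rpow_ne_top_of_nonneg
      (sub_nonneg.2 (one_div_le_one_div_of_le hq (ENNReal.toReal_mono hp hqp)))
      (measure_ne_top _ _)
  have h2 := ENNReal.Tendsto.mul_const (b := μ univ ^ (1 / q.toReal - 1 / p.toReal)) h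
    (Or.inr hM)
  rw [zero_mul] at h2
  exact tendsto_of_tendsto_of_tendsto_of_le_of_le tendsto_const_nhds h2 (fun _ => zero_le)
    fun n => eLpNorm_le_eLpNorm_mul_rpow_measure_univ hqp (hf n)

/-- Convergence in `L^p` of vector fields, from the convergence of their components. -/
lemma tendsto_eLpNorm_toLp {α : Type*} [MeasurableSpace α] {μ : Measure α} {q : ℝ≥0∞}
    (hq : 1 ≤ q) {f : ℕ → Fin N → α → ℝ} (hf : ∀ n i, AEStronglyMeasurable (f n i) μ)
    (h : ∀ i, Tendsto (fun n => eLpNorm (f n i) q μ) atTop (𝓝 0)) :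
    Tendsto (fun n => eLpNorm (fun x => (WithLp.toLp 2 fun i => f n i x : E N)) q μ) atTop
      (𝓝 0) := by
  have hs : Tendsto (fun n => ∑ i, eLpNorm (f n i) q μ) atTop (𝓝 0) := by
    have := tendsto_finsetSum (Finset.univ : Finset (Fin N)) fun i _ => h i
    simpa using this
  refine tendsto_of_tendsto_of_tendsto_of_le_of_le tendsto_const_nhds hs (fun _ => zero_le)
    fun n => ?_
  have e : (fun x => (WithLp.toLp 2 fun i => f n i x : E N)) =
      ∑ i, fun x => f n i x • (coordVec i : E N) := by
    ext x j
    simp [coordVec, Pi.single_apply]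
  rw [e]
  refine (eLpNorm_sum_le (fun i _ => (hf n i).smul_const _) hq).trans (Finset.sum_le_sum ?_)
  intro i _
  apply eLpNorm_mono
  intro x
  simp [norm_smul, coordVec]

/-- The smooth functions which define the trace of a function also approximate it in `X²` and
in `W^{1,p}(Ω)`. -/
lemma exists_tendsto_smoothPair [IsFiniteMeasure (bdry Ω b)] [h1p : Fact (1 < p)]
    (hΩo : IsOpen Ω) (hΩb : Bornology.IsBounded Ω) (hp : 2 ≤ p) {U : X2 Ω b}
    {w : Sobolev Ω 1 0 p} (h : IsVPair U (w : Jet Ω 1 p)) :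
    ∃ (φ : ℕ → E N → ℝ) (hφ : ∀ n, ContDiff ℝ ∞ (φ n)),
      Tendsto (fun n => smoothPair b hΩo hΩb p (hφ n)) atTop (𝓝 (U, gradL Ω p w)) := by
  have := isFiniteMeasure_vol hΩb
  have h2p : (2 : ℝ≥0∞) ≤ ENNReal.ofReal p := by
    rw [← ENNReal.ofReal_ofNat]
    exact ENNReal.ofReal_le_ofReal hp
  obtain ⟨hU, φ, hφ, c1, c2, c3⟩ := h
  refine ⟨φ, hφ, ?_⟩
  rw [nhds_prod_eq]
  refine Tendsto.prodMk ?_ ?_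
  · refine ((WithLp.prod_continuous_toLp 2 _ _).tendsto (U.fst, U.snd)).comp ?_
    rw [nhds_prod_eq]
    refine Tendsto.prodMk ?_ ?_
    · rw [Lp.tendsto_Lp_iff_tendsto_eLpNorm']
      have := tendsto_eLpNorm_of_exponent_le two_ne_zero h2p ENNReal.ofReal_ne_top
        (fun n => (hφ n).continuous.aestronglyMeasurable.sub (w : Jet Ω 1 p).aesm_fn) c1
      refine this.congr fun n => eLpNorm_congr_ae ?_
      filter_upwards [(memLp_vol_of_continuous hΩo hΩb (hφ n).continuous 2).coeFn_toLp, hU]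
        with x e1 e2
      simp only [Pi.sub_apply]
      rw [e1, e2]
    · rw [Lp.tendsto_Lp_iff_tendsto_eLpNorm']
      have := tendsto_eLpNorm_of_exponent_le two_ne_zero h2p ENNReal.ofReal_ne_top
        (fun n => (hφ n).continuous.aestronglyMeasurable.sub (Lp.aestronglyMeasurable U.snd)) c3
      refine this.congr fun n => eLpNorm_congr_ae ?_
      filter_upwards [(memLp_bdry_of_continuous (b := b) hΩb (hφ n).continuous 2).coeFn_toLp]
        with x e1
      simp only [Pi.sub_apply]
      rw [e1]
  · rw [Lp.tendsto_Lp_iff_tendsto_eLpNorm']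
    have cd : ∀ (n : ℕ) (i : Fin N), Continuous fun x => fderiv ℝ (φ n) x (coordVec i) :=
      fun n i => ((hφ n).continuous_fderiv (by simp)).clm_apply continuous_const
    have := tendsto_eLpNorm_toLp (factOneLeOfReal p).out
      (fun n i => ((cd n i).aestronglyMeasurable (μ := vol Ω)).sub
        ((w : Jet Ω 1 p).aesm_part i)) c2
    refine this.congr fun n => eLpNorm_congr_ae ?_
    filter_upwards [(memLp_vol_of_continuous hΩo hΩb (continuous_gradVec (hφ n))
      (ENNReal.ofReal p)).coeFn_toLp, coeFn_gradL w] with x e1 e2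
    simp only [Pi.sub_apply]
    rw [e1, e2]
    rfl

/-- The right-hand side of the equation for a difference of solutions, as a functional on pairs
`(Ξ, ∇σ)`: here `h` stands for the difference of the reaction terms, and `z` for that of the
fluxes. -/
def testFunctional (Ω : Set (E N)) (b : E N → ℝ) (p : ℝ) [Fact (1 < p)] (h : X2 Ω b)
    (z : Lp (E N) (ENNReal.ofReal (p / (p - 1))) (vol Ω)) :
    X2 Ω b × Lp (E N) (ENNReal.ofReal p) (vol Ω) →L[ℝ] ℝ :=
  -((innerBilin (X2 Ω b) h).comp (ContinuousLinearMap.fst ℝ _ _) +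
    ((innerBilin (E N)).lpPairing (vol Ω) (ENNReal.ofReal (p / (p - 1))) (ENNReal.ofReal p)
      z).comp (ContinuousLinearMap.snd ℝ _ _))

lemma testFunctional_apply [Fact (1 < p)] (h : X2 Ω b)
    (z : Lp (E N) (ENNReal.ofReal (p / (p - 1))) (vol Ω))
    (y : X2 Ω b × Lp (E N) (ENNReal.ofReal p) (vol Ω)) :
    testFunctional Ω b p h z y = -(inner ℝ h y.1 + ∫ x in Ω, inner ℝ (z x) (y.2 x)) := by
  rw [testFunctional, neg_apply, add_apply]
  congr 2
  exact ContinuousLinearMap.lpPairing_eq_integral _ _ _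

lemma memLp_testFunctional [Fact (1 < p)] {α : Type*} [MeasurableSpace α] {ν : Measure α}
    {q : ℝ≥0∞} {h : α → X2 Ω b} {z : α → Lp (E N) (ENNReal.ofReal (p / (p - 1))) (vol Ω)}
    (hh : MemLp h q ν) (hz : MemLp z q ν) :
    MemLp (fun t => testFunctional Ω b p (h t) (z t)) q ν := by
  let Y := X2 Ω b × Lp (E N) (ENNReal.ofReal p) (vol Ω)
  have m1 := hh.continuousLinearMap_comp
    (((ContinuousLinearMap.compL ℝ Y (X2 Ω b) ℝ).flip (ContinuousLinearMap.fst ℝ _ _)).comp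
      (innerBilin (X2 Ω b)))
  have m2 := hz.continuousLinearMap_comp
    (((ContinuousLinearMap.compL ℝ Y (Lp (E N) (ENNReal.ofReal p) (vol Ω)) ℝ).flip
      (ContinuousLinearMap.snd ℝ _ _)).comp
        ((innerBilin (E N)).lpPairing (vol Ω) (ENNReal.ofReal (p / (p - 1))) (ENNReal.ofReal p)))
  exact (m1.add m2).neg

end Equation

/-! ### The weak formulation for a difference of solutions -/

section Weak

variable {N : ℕ} {Ω : Set (E N)} {b : E N → ℝ} {p : ℝ}

lemma one_le_dualExp (r : ℝ) : 1 ≤ dualExp r := le_self_add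

lemma one_le_sIndex (p r₁ r₂ : ℝ) : 1 ≤ sIndex p r₁ r₂ :=
  le_min (one_le_dualExp _) (le_min (one_le_dualExp _) (one_le_dualExp _))

lemma one_le_kIndex (N : ℕ) (p r₁ r₂ : ℝ) : 1 ≤ kIndex N p r₁ r₂ := le_max_left _ _

/-- An identity between Bochner integrals of functionals, evaluated at a point. -/
lemma integral_mul_inner_eq_of_dual {F H α : Type*} [NormedAddCommGroup F] [NormedSpace ℝ F]
    [NormedAddCommGroup H] [InnerProductSpace ℝ H] [MeasurableSpace α] {μ : Measure α}
    (ι : F →L[ℝ] H) {U : α → H} (hU : Integrable U μ) {ξ : α → StrongDual ℝ F}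
    (hξ : Integrable ξ μ) {c d : α → ℝ} {C D : ℝ} (hc : AEStronglyMeasurable c μ)
    (hd : AEStronglyMeasurable d μ) (hC : ∀ t, ‖c t‖ ≤ C) (hD : ∀ t, ‖d t‖ ≤ D)
    (h : ∫ t, c t • (innerSL ℝ (U t)).comp ι ∂μ = -∫ t, d t • ξ t ∂μ) (x : F) :
    ∫ t, c t * inner ℝ (U t) (ι x) ∂μ = -∫ t, d t * ξ t x ∂μ := by
  have i1 : Integrable (fun t => d t • ξ t) μ := hξ.bdd_smul D hd (.of_forall hD)
  have i3 : Integrable (fun t => (innerSL ℝ (U t)).comp ι) μ :=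
    (((ContinuousLinearMap.compL ℝ F H ℝ).flip ι).comp (innerBilin H)).integrable_comp hU
  have i2 : Integrable (fun t => c t • (innerSL ℝ (U t)).comp ι) μ :=
    i3.bdd_smul C hc (.of_forall hC)
  have e := congrArg (fun L : StrongDual ℝ F => L x) h
  beta_reduce at e
  rw [neg_apply, ContinuousLinearMap.integral_apply i1, ContinuousLinearMap.integral_apply i2] at e
  exact e

/-- Tested with a fixed element of `V^{k,p}`, a weak solution is the primitive of its time
derivative. -/
lemma HasTimeDeriv.inner_sub_eq_integral [Fact (1 < p)] {k T : ℝ} {U : ℝ → X2 Ω b}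
    {ξ : ℝ → StrongDual ℝ (V Ω b k p)} (h : HasTimeDeriv T U ξ) (hU : ContinuousOn U (Icc 0 T))
    {s : ℝ≥0∞} (hs : 1 ≤ s) (hξ : MemLp ξ s (volume.restrict (Ioo 0 T))) (Ξ : V Ω b k p)
    {t₁ t₂ : ℝ} (h0 : 0 ≤ t₁) (h12 : t₁ ≤ t₂) (h2T : t₂ ≤ T) :
    inner ℝ (U t₂ - U t₁) Ξ.1.1 = ∫ τ in t₁..t₂, ξ τ Ξ := by
  have iξ : Integrable ξ (volume.restrict (Ioo 0 T)) := hξ.integrable hs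
  have iU : IntegrableOn U (Ioo 0 T) := hU.integrableOn_Icc.mono_set Ioo_subset_Icc_self
  have key := sub_eq_integral_of_weakDeriv (T := T) (u := fun t => inner ℝ (U t) Ξ.1.1)
    (η := fun t => ξ t Ξ) (hU.inner continuousOn_const)
    ((ContinuousLinearMap.apply ℝ ℝ Ξ).integrable_comp iξ) (fun φ hφ hc hsupp => ?_) h0 h12 h2T
  · rw [inner_sub_left]
    exact key
  · have bdd : ∀ ψ : ℝ → ℝ, Continuous ψ → HasCompactSupport ψ → ∃ C, ∀ t, ‖ψ t‖ ≤ C :=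
      fun ψ h1 h2 => h2.exists_bound_of_continuous h1
    have φ'c : Continuous (deriv φ) := hφ.continuous_deriv (by simp)
    obtain ⟨C1, hC1⟩ := bdd φ hφ.continuous hc
    obtain ⟨C2, hC2⟩ := bdd (deriv φ) φ'c hc.deriv
    exact integral_mul_inner_eq_of_dual (V.toX2 Ω b k p) iU iξ φ'c.aestronglyMeasurable
      hφ.continuous.aestronglyMeasurable hC2 hC1 (h φ hφ hc hsupp) Ξ

/-- An almost everywhere identity between functionals at a fixed point, integrated in time. -/
lemma integral_sub_integral_eq_integral_apply {Y : Type*} [NormedAddCommGroup Y] [NormedSpace ℝ Y]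
    {T s t : ℝ} {A : ℝ → StrongDual ℝ Y} {l₁ l₂ : ℝ → ℝ} {y : Y} (hA : IntegrableOn A (Ioo 0 T))
    (h₁ : IntegrableOn l₁ (Ioo 0 T)) (h₂ : IntegrableOn l₂ (Ioo 0 T))
    (h : ∀ᵐ τ ∂(volume.restrict (Ioo 0 T)), l₁ τ - l₂ τ = A τ y)
    (hs : 0 ≤ s) (hst : s ≤ t) (ht : t ≤ T) :
    (∫ τ in s..t, l₁ τ) - (∫ τ in s..t, l₂ τ) = (∫ τ in s..t, A τ) y := by
  have ii : ∀ {c : ℝ → ℝ}, IntegrableOn c (Ioo 0 T) →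
      IntervalIntegrable c volume s t := fun hc => by
    rw [intervalIntegrable_iff_integrableOn_Ioo_of_le hst]
    exact hc.mono_set (Ioo_subset_Ioo hs ht)
  have iA : IntervalIntegrable A volume s t := by
    rw [intervalIntegrable_iff_integrableOn_Ioo_of_le hst]
    exact hA.mono_set (Ioo_subset_Ioo hs ht)
  rw [← intervalIntegral.integral_sub (ii h₁) (ii h₂),
    ContinuousLinearMap.intervalIntegral_apply iA, intervalIntegral.integral_of_le hst,
    intervalIntegral.integral_of_le hst, integral_Ioc_eq_integral_Ioo,
    integral_Ioc_eq_integral_Ioo]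
  exact integral_congr_ae
    (ae_restrict_of_ae_restrict_of_subset (Ioo_subset_Ioo hs ht) h)

/-- Subtracting the weak formulations of two bounded solutions: the data `h₁`, `h₂` cancel, and the
reaction terms may be replaced by their Lipschitz cutoffs. -/
lemma sub_eq_testFunctional [Fact (1 < p)] [IsFiniteMeasure (vol Ω)] {a : ℝ → ℝ}
    (ha : FluxAssumptions N p a) (hp : 2 ≤ p) {f g F G : ℝ → ℝ} {K : NNReal} {C : ℝ}
    (hF : LipschitzWith K F) (hF0 : F 0 = 0) (hG : LipschitzWith K G) (hG0 : G 0 = 0)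
    (hfF : ∀ x y, |x| ≤ C → |y| ≤ C → F x - F y = f x - f y)
    (hgG : ∀ x y, |x| ≤ C → |y| ≤ C → G x - G y = g x - g y)
    {u₁ u₂ Ξ : X2 Ω b} {w₁ w₂ : Sobolev Ω 1 0 p} {D : E N → E N}
    {d : Lp (E N) (ENNReal.ofReal p) (vol Ω)} (hd : d =ᵐ[vol Ω] D)
    (hu₁ : ∀ᵐ x ∂(vol Ω), |u₁.fst x| ≤ C) (hv₁ : ∀ᵐ x ∂(bdry Ω b), |u₁.snd x| ≤ C)
    (hu₂ : ∀ᵐ x ∂(vol Ω), |u₂.fst x| ≤ C) (hv₂ : ∀ᵐ x ∂(bdry Ω b), |u₂.snd x| ≤ C)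
    (if₁ : Integrable (fun x => f (u₁.fst x) * Ξ.fst x) (vol Ω))
    (if₂ : Integrable (fun x => f (u₂.fst x) * Ξ.fst x) (vol Ω))
    (ig₁ : Integrable (fun x => g (u₁.snd x) * Ξ.snd x) (bdry Ω b))
    (ig₂ : Integrable (fun x => g (u₂.snd x) * Ξ.snd x) (bdry Ω b))
    {l₁ l₂ R : ℝ}
    (h₁ : l₁ + (∫ x in Ω, a (‖(w₁ : Jet Ω 1 p).grad x‖ ^ 2) *
        inner ℝ ((w₁ : Jet Ω 1 p).grad x) (D x)) + (∫ x in Ω, f (u₁.fst x) * Ξ.fst x) +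
        (∫ x, g (u₁.snd x) * Ξ.snd x ∂(bdry Ω b)) = R)
    (h₂ : l₂ + (∫ x in Ω, a (‖(w₂ : Jet Ω 1 p).grad x‖ ^ 2) *
        inner ℝ ((w₂ : Jet Ω 1 p).grad x) (D x)) + (∫ x in Ω, f (u₂.fst x) * Ξ.fst x) +
        (∫ x, g (u₂.snd x) * Ξ.snd x ∂(bdry Ω b)) = R) :
    l₁ - l₂ = testFunctional Ω b p (reaction hF hF0 hG hG0 u₁ - reaction hF hF0 hG hG0 u₂)
      (nemFlux ha hp (gradL Ω p w₁) - nemFlux ha hp (gradL Ω p w₂)) (Ξ, d) := by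
  have flux_int : ∀ w : Sobolev Ω 1 0 p,
      ∫ x in Ω, a (‖(w : Jet Ω 1 p).grad x‖ ^ 2) * inner ℝ ((w : Jet Ω 1 p).grad x) (D x) =
      ∫ x in Ω, inner ℝ (nemFlux ha hp (gradL Ω p w) x) (d x) := by
    intro w
    apply integral_congr_ae
    filter_upwards [coeFn_nemFlux ha hp (gradL Ω p w), coeFn_gradL w, hd] with x e1 e2 e3
    rw [e1, e2, e3, flux, real_inner_smul_left]
  have flux_sub : ∫ x in Ω, inner ℝ ((nemFlux ha hp (gradL Ω p w₁) -
      nemFlux ha hp (gradL Ω p w₂) : Lp (E N) _ (vol Ω)) x) (d x) =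
      (∫ x in Ω, inner ℝ (nemFlux ha hp (gradL Ω p w₁) x) (d x)) -
      ∫ x in Ω, inner ℝ (nemFlux ha hp (gradL Ω p w₂) x) (d x) := by
    have := fun z => ContinuousLinearMap.lpPairing_eq_integral (μ := vol Ω)
      (p := ENNReal.ofReal (p / (p - 1))) (q := ENNReal.ofReal p) (innerBilin (E N)) z d
    simp only [innerBilin_apply] at this
    rw [← this, ← this, ← this, map_sub, sub_apply]
  have reac : ∀ {μ : Measure (E N)} {f F : ℝ → ℝ} (hF : LipschitzWith K F) (hF0 : F 0 = 0)
      (_ : ∀ x y, |x| ≤ C → |y| ≤ C → F x - F y = f x - f y) (v₁ v₂ σ : Lp ℝ 2 μ)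
      (_ : ∀ᵐ x ∂μ, |v₁ x| ≤ C) (_ : ∀ᵐ x ∂μ, |v₂ x| ≤ C)
      (_ : Integrable (fun x => f (v₁ x) * σ x) μ) (_ : Integrable (fun x => f (v₂ x) * σ x) μ),
      inner ℝ (hF.compLp hF0 v₁ - hF.compLp hF0 v₂) σ =
        (∫ x, f (v₁ x) * σ x ∂μ) - ∫ x, f (v₂ x) * σ x ∂μ := by
    intro μ f F hF hF0 hfF v₁ v₂ σ b1 b2 i1 i2
    rw [L2.inner_def, ← integral_sub i1 i2]
    apply integral_congr_ae
    filter_upwards [Lp.coeFn_sub (hF.compLp hF0 v₁) (hF.compLp hF0 v₂), hF.coeFn_compLp hF0 v₁,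
      hF.coeFn_compLp hF0 v₂, b1, b2] with x e0 e1 e2 c1 c2
    rw [e0, Pi.sub_apply, e1, e2, Function.comp_apply, Function.comp_apply, hfF _ _ c1 c2]
    simp only [RCLike.inner_apply, conj_trivial]
    ring
  have r1 := reac hF hF0 hfF u₁.fst u₂.fst Ξ.fst hu₁ hu₂ if₁ if₂
  have r2 := reac hG hG0 hgG u₁.snd u₂.snd Ξ.snd hv₁ hv₂ ig₁ ig₂
  have r3 : inner ℝ (reaction hF hF0 hG hG0 u₁ - reaction hF hF0 hG hG0 u₂) Ξ =
      inner ℝ (hF.compLp hF0 u₁.fst - hF.compLp hF0 u₂.fst) Ξ.fst +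
      inner ℝ (hG.compLp hG0 u₁.snd - hG.compLp hG0 u₂.snd) Ξ.snd :=
    WithLp.prod_inner_apply _ _
  rw [testFunctional_apply, flux_sub, r3, r1, r2, ← flux_int, ← flux_int]
  linarith

/-- Dissipativity: the flux is monotone, and the reaction is Lipschitz. -/
lemma testFunctional_le [Fact (1 < p)] [IsFiniteMeasure (vol Ω)] {a : ℝ → ℝ}
    (ha : FluxAssumptions N p a) (hp : 2 ≤ p) {F G : ℝ → ℝ} {K : NNReal}
    (hF : LipschitzWith K F) (hF0 : F 0 = 0) (hG : LipschitzWith K G) (hG0 : G 0 = 0)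
    (u₁ u₂ : X2 Ω b) (d₁ d₂ : Lp (E N) (ENNReal.ofReal p) (vol Ω)) :
    testFunctional Ω b p (reaction hF hF0 hG hG0 u₁ - reaction hF hF0 hG hG0 u₂)
      (nemFlux ha hp d₁ - nemFlux ha hp d₂) (u₁ - u₂, d₁ - d₂) ≤ K * ‖u₁ - u₂‖ ^ 2 := by
  rw [testFunctional_apply]
  have h1 : 0 ≤ ∫ x in Ω, inner ℝ ((nemFlux ha hp d₁ - nemFlux ha hp d₂ : Lp (E N) _ (vol Ω)) x)
      ((d₁ - d₂ : Lp (E N) _ (vol Ω)) x) := by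
    apply integral_nonneg_of_ae
    filter_upwards [Lp.coeFn_sub (nemFlux ha hp d₁) (nemFlux ha hp d₂), Lp.coeFn_sub d₁ d₂,
      coeFn_nemFlux ha hp d₁, coeFn_nemFlux ha hp d₂] with x e1 e2 e3 e4
    rw [e1, e2, Pi.sub_apply, Pi.sub_apply, e3, e4]
    exact ha.monotone _ _
  have h2 := norm_inner_le_norm (𝕜 := ℝ)
    (reaction hF hF0 hG hG0 u₁ - reaction hF hF0 hG hG0 u₂) (u₁ - u₂)
  have h3 := (lipschitzWith_reaction (Ω := Ω) (b := b) hF hF0 hG hG0).norm_sub_le u₁ u₂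
  have h4 := mul_le_mul_of_nonneg_right h3 (norm_nonneg (u₁ - u₂))
  have h5 := neg_abs_le (inner ℝ (reaction hF hF0 hG hG0 u₁ - reaction hF hF0 hG hG0 u₂) (u₁ - u₂))
  rw [Real.norm_eq_abs] at h2
  change -(inner ℝ _ (u₁ - u₂) + _) ≤ _
  nlinarith

lemma ae_abs_le_of_xInftyNorm_le {U : X2 Ω b} {C : NNReal} (h : xInftyNorm U ≤ C) :
    (∀ᵐ x ∂(vol Ω), |U.fst x| ≤ C) ∧ ∀ᵐ x ∂(bdry Ω b), |U.snd x| ≤ C := by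
  have key : ∀ {μ : Measure (E N)} {v : E N → ℝ}, eLpNorm v ⊤ μ ≤ C → ∀ᵐ x ∂μ, |v x| ≤ C := by
    intro μ v hv
    rw [eLpNorm_exponent_top] at hv
    filter_upwards [ae_le_eLpNormEssSup (f := v) (μ := μ)] with x hx
    have h1 := hx.trans hv
    rw [enorm_le_coe] at h1
    exact_mod_cast h1
  exact ⟨key ((le_max_left _ _).trans h), key ((le_max_right _ _).trans h)⟩

end Weak

end DynBC
end

/-! ### Uniqueness -/

set_option maxHeartbeats 800000 in
theorem theorem3p16
    (N : ℕ) (hN : 1 ≤ N)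
    (Ω : Set (DynBC.E N)) (hΩo : IsOpen Ω) (hΩc : IsConnected Ω) (hΩb : Bornology.IsBounded Ω)
    (hΩs : DynBC.HasSmoothBoundary Ω)
    (b : DynBC.E N → ℝ) (hb : MemLp b ∞ (DynBC.surface Ω))
    (hb₀ : ∃ b₀ > 0, ∀ᵐ x ∂(DynBC.surface Ω), b₀ ≤ b x)
    (p : ℝ) [Fact (1 < p)] (hp : 2 ≤ p)
    (r₁ r₂ : ℝ) (hr₁ : 1 ≤ r₁) (hr₂ : 1 ≤ r₂)
    (a : ℝ → ℝ) (ha : DynBC.FluxAssumptions N p a)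
    (f g : ℝ → ℝ) (hf : ContDiff ℝ 1 f) (hg : ContDiff ℝ 1 g)
    (h₁ h₂ : DynBC.E N → ℝ)
    (hh₁ : MemLp h₁ (DynBC.dualExp r₁) (DynBC.vol Ω))
    (hh₂ : MemLp h₂ (DynBC.dualExp r₂) (DynBC.bdry Ω b))
    (T : ℝ) (hT : 0 < T)
    (U₀₁ U₀₂ : DynBC.X2 Ω b) (U₁ U₂ : ℝ → DynBC.X2 Ω b)
    (hU₁ : DynBC.IsWeakSolution Ω b p r₁ r₂ a f g h₁ h₂ T U₀₁ U₁)
    (hU₂ : DynBC.IsWeakSolution Ω b p r₁ r₂ a f g h₁ h₂ T U₀₂ U₂)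
    (hc₁ : ContinuousOn U₁ (Icc 0 T)) (hc₂ : ContinuousOn U₂ (Icc 0 T))
    (hb₁ : ∃ C : NNReal, ∀ᵐ t ∂(volume.restrict (Ioo 0 T)), DynBC.xInftyNorm (U₁ t) ≤ C)
    (hb₂ : ∃ C : NNReal, ∀ᵐ t ∂(volume.restrict (Ioo 0 T)), DynBC.xInftyNorm (U₂ t) ≤ C)
    (h0 : U₁ 0 = U₂ 0) :
    ∀ t ∈ Icc (0 : ℝ) T, U₁ t = U₂ t := by
  have hvol := DynBC.isFiniteMeasure_vol hΩb
  have hbdry := DynBC.isFiniteMeasure_bdry (b := b) hΩo hΩb hΩs hb₀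
  obtain ⟨-, -, hU₁m, -, w₁, ξ₁, hw₁, hξ₁, hd₁, hV₁, heq₁⟩ := hU₁
  obtain ⟨-, -, hU₂m, -, w₂, ξ₂, hw₂, hξ₂, hd₂, hV₂, heq₂⟩ := hU₂
  obtain ⟨C₁, hC₁⟩ := hb₁
  obtain ⟨C₂, hC₂⟩ := hb₂
  -- Lipschitz cutoffs of the nonlinearities, on the range of both solutions
  obtain ⟨Kf, F, hF, hF0, hfF⟩ :=
    DynBC.exists_lipschitz_cutoff hf (C := (max C₁ C₂ : NNReal)) (NNReal.coe_nonneg _)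
  obtain ⟨Kg, G, hG, hG0, hgG⟩ :=
    DynBC.exists_lipschitz_cutoff hg (C := (max C₁ C₂ : NNReal)) (NNReal.coe_nonneg _)
  replace hF := hF.weaken (le_max_left Kf Kg)
  replace hG := hG.weaken (le_max_right Kf Kg)
  generalize max Kf Kg = K at hF hG
  have bd₁ : ∀ᵐ t ∂(volume.restrict (Ioo 0 T)),
      DynBC.xInftyNorm (U₁ t) ≤ (max C₁ C₂ : NNReal) := by
    filter_upwards [hC₁] with t ht
    exact ht.trans (by exact_mod_cast le_max_left _ _)
  have bd₂ : ∀ᵐ t ∂(volume.restrict (Ioo 0 T)),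
      DynBC.xInftyNorm (U₂ t) ≤ (max C₁ C₂ : NNReal) := by
    filter_upwards [hC₂] with t ht
    exact ht.trans (by exact_mod_cast le_max_right _ _)
  let R : DynBC.X2 Ω b → DynBC.X2 Ω b := DynBC.reaction hF hF0 hG hG0
  let A : ℝ → StrongDual ℝ (DynBC.X2 Ω b × Lp (DynBC.E N) (ENNReal.ofReal p) (DynBC.vol Ω)) :=
    fun t => DynBC.testFunctional Ω b p (R (U₁ t) - R (U₂ t))
      (DynBC.nemFlux ha hp (DynBC.gradL Ω p (w₁ t)) - DynBC.nemFlux ha hp (DynBC.gradL Ω p (w₂ t)))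
  let y : ℝ → DynBC.X2 Ω b × Lp (DynBC.E N) (ENNReal.ofReal p) (DynBC.vol Ω) :=
    fun t => (U₁ t - U₂ t, DynBC.gradL Ω p (w₁ t) - DynBC.gradL Ω p (w₂ t))
  have hA : MemLp A (ENNReal.ofReal (p / (p - 1))) (volume.restrict (Ioo 0 T)) := by
    have hR : ∀ U : ℝ → DynBC.X2 Ω b, MemLp U ⊤ (volume.restrict (Ioo 0 T)) →
        MemLp (fun t => R (U t)) (ENNReal.ofReal (p / (p - 1))) (volume.restrict (Ioo 0 T)) :=
      fun U hU => ((DynBC.lipschitzWith_reaction hF hF0 hG hG0).comp_memLp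
        (DynBC.reaction_zero hF hF0 hG hG0) hU).mono_exponent le_top
    exact DynBC.memLp_testFunctional ((hR U₁ hU₁m).sub (hR U₂ hU₂m))
      ((DynBC.memLp_nemFlux ha hp (hw₁.continuousLinearMap_comp _)).sub
        (DynBC.memLp_nemFlux ha hp (hw₂.continuousLinearMap_comp _)))
  have hy : MemLp y (ENNReal.ofReal p) (volume.restrict (Ioo 0 T)) := by
    have m1 := ((hU₁m.sub hU₂m).mono_exponent
      (le_top : ENNReal.ofReal p ≤ ⊤)).continuousLinearMap_comp
        (ContinuousLinearMap.inl ℝ (DynBC.X2 Ω b)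
          (Lp (DynBC.E N) (ENNReal.ofReal p) (DynBC.vol Ω)))
    have m2 := ((hw₁.continuousLinearMap_comp (DynBC.gradL Ω p)).sub
      (hw₂.continuousLinearMap_comp (DynBC.gradL Ω p))).continuousLinearMap_comp
        (ContinuousLinearMap.inr ℝ (DynBC.X2 Ω b)
          (Lp (DynBC.E N) (ENNReal.ofReal p) (DynBC.vol Ω)))
    refine (m1.add m2).ae_eq (.of_forall fun t => ?_)
    simp [y]
  have iA : IntegrableOn A (Ioo 0 T) := hA.integrable Fact.out
  -- the equation for the difference, tested with smooth functions
  have smooth : ∀ (φ : DynBC.E N → ℝ) (hφ : ContDiff ℝ ∞ φ) (s t : ℝ), 0 ≤ s → s ≤ t → t ≤ T →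
      inner ℝ ((U₁ t - U₂ t) - (U₁ s - U₂ s)) (DynBC.smoothPair b hΩo hΩb p hφ).1 =
        (∫ τ in s..t, A τ) (DynBC.smoothPair b hΩo hΩb p hφ) := by
    intro φ hφ s t hs hst ht
    obtain ⟨Ξ, hΞ, hgr⟩ := DynBC.exists_mem_V_smoothPair (b := b) (p := p) hN hΩo hΩb
      (DynBC.one_le_kIndex N p r₁ r₂) hφ
    have i₁ := hd₁.inner_sub_eq_integral hc₁ (DynBC.one_le_sIndex p r₁ r₂) hξ₁ Ξ hs hst ht
    have i₂ := hd₂.inner_sub_eq_integral hc₂ (DynBC.one_le_sIndex p r₁ r₂) hξ₂ Ξ hs hst ht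
    have hint : ∀ ξ : ℝ → StrongDual ℝ (DynBC.V Ω b (DynBC.kIndex N p r₁ r₂) p),
        MemLp ξ (DynBC.sIndex p r₁ r₂) (volume.restrict (Ioo 0 T)) →
        IntegrableOn (fun τ => ξ τ Ξ) (Ioo 0 T) := fun ξ hξ =>
      (ContinuousLinearMap.apply ℝ ℝ Ξ).integrable_comp
        (hξ.integrable (DynBC.one_le_sIndex p r₁ r₂))
    have e4 : (U₁ t - U₂ t) - (U₁ s - U₂ s) = (U₁ t - U₁ s) - (U₂ t - U₂ s) := by abel
    rw [e4, inner_sub_left, ← hΞ, i₁, i₂]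
    refine DynBC.integral_sub_integral_eq_integral_apply (A := A) (l₁ := fun τ => ξ₁ τ Ξ)
      (l₂ := fun τ => ξ₂ τ Ξ) iA (hint ξ₁ hξ₁) (hint ξ₂ hξ₂) ?_ hs hst ht
    filter_upwards [heq₁ Ξ, heq₂ Ξ, bd₁, bd₂] with τ h₁ h₂ b₁ b₂
    obtain ⟨f₁, g₁, h₁⟩ := h₁
    obtain ⟨f₂, g₂, h₂⟩ := h₂
    obtain ⟨bu₁, bv₁⟩ := DynBC.ae_abs_le_of_xInftyNorm_le b₁
    obtain ⟨bu₂, bv₂⟩ := DynBC.ae_abs_le_of_xInftyNorm_le b₂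
    have := DynBC.sub_eq_testFunctional ha hp hF hF0 hG hG0 hfF hgG hgr bu₁ bv₁ bu₂ bv₂
      f₁ f₂ g₁ g₂ h₁ h₂
    rwa [hΞ] at this
  -- by density, the difference itself is admissible
  have admissible : ∀ᵐ r ∂(volume.restrict (Ioo 0 T)), ∀ s t, 0 ≤ s → s ≤ t → t ≤ T →
      inner ℝ ((U₁ t - U₂ t) - (U₁ s - U₂ s)) (U₁ r - U₂ r) = ∫ τ in s..t, A τ (y r) := by
    filter_upwards [hV₁, hV₂] with r hr₁ hr₂ s t hs hst ht
    have hr : DynBC.IsVPair (U₁ r - U₂ r) ((w₁ r - w₂ r : DynBC.Sobolev Ω 1 0 p) :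
        DynBC.Jet Ω 1 p) := by
      have := hr₁.lin (-1) hr₂
      rwa [neg_one_smul, neg_one_smul, ← sub_eq_add_neg, ← sub_eq_add_neg] at this
    obtain ⟨φ, hφ, hlim⟩ := DynBC.exists_tendsto_smoothPair hΩo hΩb hp hr
    rw [map_sub] at hlim
    have iAst : IntervalIntegrable A volume s t := by
      rw [intervalIntegrable_iff_integrableOn_Ioo_of_le hst]
      exact iA.mono_set (Ioo_subset_Ioo hs ht)
    rw [← ContinuousLinearMap.intervalIntegral_apply iAst]
    have c1 : Continuous fun z : DynBC.X2 Ω b ×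
        Lp (DynBC.E N) (ENNReal.ofReal p) (DynBC.vol Ω) =>
        inner ℝ ((U₁ t - U₂ t) - (U₁ s - U₂ s)) z.1 := continuous_const.inner continuous_fst
    refine tendsto_nhds_unique ((c1.tendsto _).comp hlim)
      ((((∫ τ in s..t, A τ).continuous.tendsto _).comp hlim).congr fun n => ?_)
    exact (smooth (φ n) (hφ n) s t hs hst ht).symm
  have zero := DynBC.eq_zero_of_energy (W := fun t => U₁ t - U₂ t) (L := K) ENNReal.ofReal_ne_top
    K.coe_nonneg (hc₁.sub hc₂) (sub_eq_zero.2 h0) hA hy admissible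
    (.of_forall fun t => DynBC.testFunctional_le ha hp hF hF0 hG hG0 (U₁ t) (U₂ t) _ _)
  exact fun t ht => sub_eq_zero.1 (zero t ht)
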